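/- \textbf{Setting.} A compact matrix quantum group $G$ is given by its Hopf $*$-algebra $\mathcal A$ of polynomial functions, that is, a complex Hopf algebra with comultiplication $\phi$, counit $\epsilon$ and antipode $\kappa$, and with an antilinear involution making it a $*$-algebra for which $\phi$ is a $*$-homomorphism, which is generated as an algebra by the matrix elements of some finite-dimensional unitary representation of $G$ (a unitary matrix $u\in M_n(\mathcal A)$ with $\phi(u_{ij})=\sum_k u_{ik}\otimes u_{kj}$ and $\epsilon(u_{ij})=\delta_{ij}$). Let $\Gamma$ be a bicovariant first-order $*$-calculus over $G$: an $\mathcal A$-bimodule with a derivation $d\colon\mathcal A\to\Gamma$ such that $\Gamma$ is spanned by the elements $a\,db$, and such that the formulas $$\ell_\Gamma(a\,db)=\phi(a)(\mathrm{id}\otimes d)\phi(b),\qquad \wp_\Gamma(a\,db)=\phi(a)(d\otimes \mathrm{id})\phi(b),\qquad (a\,db)^*=d(b^*)\,a^*$$ consistently define linear maps $\ell_\Gamma\colon\Gamma\to\mathcal A\otimes\Gamma$, $\wp_\Gamma\colon\Gamma\to\Gamma\otimes\mathcal A$ and an antilinear involution of $\Gamma$. Let $\Gamma_{inv}=\{\vartheta\in\Gamma:\ell_\Gamma(\vartheta)=1\otimes\vartheta\}$,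 and let $\varpi\colon\Gamma_{inv}\to\Gamma_{inv}\otimes\mathcal A$ be the restriction of $\wp_\Gamma$. Let $\Gamma^\wedge$ be the universal differential envelope of $\Gamma$, the quotient of the tensor bundle algebra of $\Gamma$ over $\mathcal A$ by the ideal generated by the elements $\sum_i da_i\otimes_{\mathcal A} db_i$ with $\sum_i a_i\,db_i=0$, with its natural grading and differential. Let $p_k\colon\Gamma^\wedge\to\Gamma^{\wedge k}$ be the projections onto the homogeneous components, and let $\pi_{inv}$ be the canonical projection of $\Gamma^\wedge$ onto its left-invariant elements $\Gamma^\wedge_{inv}$. Let $P=(\mathcal B,i,F)$ be a quantum principal $G$-bundle over a quantum space with unital $*$-algebra $\mathcal V$: $\mathcal B$ is a unital $*$-algebra, and $i\colon\mathcal V\to\mathcal B$ and $F\colon\mathcal B\to\mathcal B\otimes\mathcal A$ are unital $*$-homomorphisms such that $i$ is injective with image $\{b\in\mathcal B: F(b)=b\otimes1\}$, such that $(\mathrm{id}\otimes\epsilon)F=\mathrm{id}$ and $(\mathrm{id}\otimes\phi)F=(F\otimes\mathrm{id})F$, and such that the map $\mathcal B\otimes\mathcal B\to\mathcal B\otimes\mathcal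 A$, $q\otimes b\mapsto qF(b)$, is surjective. Let $\Omega(P)=\bigoplus_{k\ge0}\Omega^k(P)$ be a graded-differential $*$-algebra (with hermitian differential and graded-antimultiplicative involution) with $\Omega^0(P)=\mathcal B$, such that (diff1) $\Omega(P)$ is generated by $\mathcal B$ as a differential algebra; (diff2) $F$ extends to a homomorphism $\widehat F\colon\Omega(P)\to\Omega(P)\mathbin{\widehat\otimes}\Gamma^\wedge$ of graded-differential algebras, where $\widehat\otimes$ is the graded tensor product. Put $F^\wedge=(\mathrm{id}\otimes p_0)\widehat F\colon\Omega(P)\to\Omega(P)\otimes\mathcal A$, and let $\pi_v\colon\Omega(P)\to\mathcal B\otimes\Gamma^\wedge_{inv}$ be the verticalizing map, $\pi_v(w)=(\mathrm{id}\otimes\pi_{inv}\,p_k)\widehat F(w)$ for $w\in\Omega^k(P)$. \textbf{Theorem.} Under these assumptions $P$ admits at least one connection: there is a linear map $\omega\colon\Gamma_{inv}\to\Omega(P)$ such that for all $\vartheta\in\Gamma_{inv}$ $$\omega(\vartheta)\in\Omega^1(P),\qquad F^\wedge\omega(\vartheta)=(\omega\otimes\mathrm{id})\varpi(\vartheta),\qquad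 \omega(\vartheta^*)=\omega(\vartheta)^*,\qquad \pi_v\,\omega(\vartheta)=1\otimes\vartheta.$$ -/

import Mathlib

open scoped TensorProduct DirectSum

noncomputable section

set_option linter.unusedSectionVars false

namespace QuantumBundle

open MulOpposite (op)

/-! ### Compact matrix quantum groups -/

/-- `A` is the Hopf `*`-algebra of polynomial functions on a compact matrix quantum group: the
comultiplication is a `*`-homomorphism, and `A` is generated as an algebra by the matrix elements
of a finite-dimensional unitary representation `u` of the quantum group. (The `*`-compatibility of
the counit and of the antipode follows from the one of the comultiplication.) -/
class IsCompactMatrixQuantumGroup (A : Type*) [Ring A] [StarRing A] [HopfAlgebra ℂ A]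
    [StarModule ℂ A] : Prop where
  comul_star : ∀ a : A, Coalgebra.comul (R := ℂ) (star a) = star (Coalgebra.comul (R := ℂ) a)
  exists_unitary : ∃ (n : ℕ) (u : Matrix (Fin n) (Fin n) A),
    u ∈ unitary (Matrix (Fin n) (Fin n) A) ∧
    (∀ i j, Coalgebra.comul (R := ℂ) (u i j) = ∑ k, u i k ⊗ₜ[ℂ] u k j) ∧
    (∀ i j, Coalgebra.counit (R := ℂ) (u i j) = if i = j then 1 else 0) ∧
    Algebra.adjoin ℂ {a | ∃ i j, a = u i j} = ⊤

/-! ### First-order differential calculi -/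

section Calculus

variable (A Γ : Type*) [Ring A] [Algebra ℂ A]
  [AddCommGroup Γ] [Module ℂ Γ] [Module A Γ] [Module Aᵐᵒᵖ Γ] [SMulCommClass A Aᵐᵒᵖ Γ]
  [IsScalarTower ℂ A Γ] [IsScalarTower ℂ Aᵐᵒᵖ Γ]

/-- A first-order differential calculus over `A`: an `A`-bimodule `Γ` with a derivation
`d : A → Γ` such that `Γ` is spanned by the elements `a d(b)`. The right action `γ a` is written
`op a • γ`. -/
structure FirstOrderCalculus where
  d : A →ₗ[ℂ] Γ
  leibniz : ∀ a b : A, d (a * b) = a • d b + op b • d a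
  span_eq_top : Submodule.span ℂ {γ : Γ | ∃ a b : A, γ = a • d b} = ⊤

end Calculus

namespace FirstOrderCalculus

variable {A Γ : Type*} [Ring A] [Algebra ℂ A]
  [AddCommGroup Γ] [Module ℂ Γ] [Module A Γ] [Module Aᵐᵒᵖ Γ] [SMulCommClass A Aᵐᵒᵖ Γ]
  [IsScalarTower ℂ A Γ] [IsScalarTower ℂ Aᵐᵒᵖ Γ]
  (C : FirstOrderCalculus A Γ)

/-- The map `a ⊗ b ↦ a d(b)`. -/
def toForm : A ⊗[ℂ] A →ₗ[ℂ] Γ :=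
  TensorProduct.lift ((Algebra.lsmul ℂ ℂ Γ).toLinearMap.compl₂ C.d)

@[simp] theorem toForm_tmul (a b : A) : C.toForm (a ⊗ₜ b) = a • C.d b := rfl

theorem toForm_surjective : Function.Surjective C.toForm := by
  rw [← LinearMap.range_eq_top, eq_top_iff, ← C.span_eq_top, Submodule.span_le]
  rintro _ ⟨a, b, rfl⟩
  exact ⟨a ⊗ₜ b, rfl⟩

/-- The linear map out of `Γ` determined by its values on the elements `a d(b)`. -/
def desc {M : Type*} [AddCommGroup M] [Module ℂ M] (f : A ⊗[ℂ] A →ₗ[ℂ] M)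
    (hf : ∀ t, C.toForm t = 0 → f t = 0) : Γ →ₗ[ℂ] M :=
  (LinearMap.ker C.toForm).liftQ f (fun t ht => hf t ht) ∘ₗ
    (C.toForm.quotKerEquivOfSurjective C.toForm_surjective).symm.toLinearMap

theorem desc_toForm {M : Type*} [AddCommGroup M] [Module ℂ M] (f : A ⊗[ℂ] A →ₗ[ℂ] M)
    (hf : ∀ t, C.toForm t = 0 → f t = 0) (t : A ⊗[ℂ] A) : C.desc f hf (C.toForm t) = f t := by
  have : (C.toForm.quotKerEquivOfSurjective C.toForm_surjective).symm (C.toForm t)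
      = Submodule.Quotient.mk t := by
    rw [LinearEquiv.symm_apply_eq]; rfl
  simp only [desc, LinearMap.comp_apply, LinearEquiv.coe_coe, this]
  rfl

theorem desc_smul_d {M : Type*} [AddCommGroup M] [Module ℂ M] (f : A ⊗[ℂ] A →ₗ[ℂ] M)
    (hf : ∀ t, C.toForm t = 0 → f t = 0) (a b : A) :
    C.desc f hf (a • C.d b) = f (a ⊗ₜ b) :=
  C.desc_toForm f hf (a ⊗ₜ b)

theorem induction {p : Γ → Prop} (h : ∀ a b : A, p (a • C.d b)) (hadd : ∀ x y, p x → p y → p (x + y))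
    (γ : Γ) : p γ := by
  obtain ⟨t, rfl⟩ := C.toForm_surjective γ
  induction t with
  | zero => simpa using h 0 0
  | tmul a b => exact h a b
  | add x y hx hy => rw [map_add]; exact hadd _ _ hx hy

theorem d_one : C.d 1 = 0 := by
  have := C.leibniz 1 1
  simpa using this

theorem op_smul_smul_d (a b c : A) :
    op c • a • C.d b = a • C.d (b * c) - (a * b) • C.d c := by
  rw [C.leibniz, smul_add, mul_smul, smul_comm a (op c)]
  abel

end FirstOrderCalculus

/-! ### The universal differential envelope -/

section Envelope

variable {A Γ : Type*} [Ring A] [Algebra ℂ A]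
  [AddCommGroup Γ] [Module ℂ Γ] [Module A Γ] [Module Aᵐᵒᵖ Γ] [SMulCommClass A Aᵐᵒᵖ Γ]
  [IsScalarTower ℂ A Γ] [IsScalarTower ℂ Aᵐᵒᵖ Γ]

/-- The relations that define the universal differential envelope on the generators `A ⊕ Γ`. The
first four present the tensor bundle algebra of the bimodule `Γ` over `A`, and the last one says
that `∑ d(aᵢ) d(bᵢ) = 0` whenever `∑ aᵢ d(bᵢ) = 0`. -/
inductive EnvelopeRel (C : FirstOrderCalculus A Γ) :
    TensorAlgebra ℂ (A × Γ) → TensorAlgebra ℂ (A × Γ) → Prop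
  | one : EnvelopeRel C (TensorAlgebra.ι ℂ (1, 0)) 1
  | mul (a b : A) : EnvelopeRel C
      (TensorAlgebra.ι ℂ (a, 0) * TensorAlgebra.ι ℂ (b, 0)) (TensorAlgebra.ι ℂ (a * b, 0))
  | left (a : A) (γ : Γ) : EnvelopeRel C
      (TensorAlgebra.ι ℂ (a, 0) * TensorAlgebra.ι ℂ (0, γ)) (TensorAlgebra.ι ℂ (0, a • γ))
  | right (γ : Γ) (a : A) : EnvelopeRel C
      (TensorAlgebra.ι ℂ (0, γ) * TensorAlgebra.ι ℂ (a, 0)) (TensorAlgebra.ι ℂ (0, op a • γ))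
  | diff (n : ℕ) (a b : Fin n → A) (h : ∑ i, a i • C.d (b i) = 0) : EnvelopeRel C
      (∑ i, TensorAlgebra.ι ℂ (0, C.d (a i)) * TensorAlgebra.ι ℂ (0, C.d (b i))) 0

/-- The universal differential envelope of a first-order calculus, that is, the quotient of the
tensor bundle algebra of `Γ` over `A` by the ideal generated by the elements `∑ d(aᵢ) ⊗ d(bᵢ)` with
`∑ aᵢ d(bᵢ) = 0`. -/
def Envelope (C : FirstOrderCalculus A Γ) : Type _ := RingQuot (EnvelopeRel C)

namespace Envelope

variable (C : FirstOrderCalculus A Γ)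

instance : Ring (Envelope C) := inferInstanceAs (Ring (RingQuot (EnvelopeRel C)))

instance : Algebra ℂ (Envelope C) := inferInstanceAs (Algebra ℂ (RingQuot (EnvelopeRel C)))

/-- The quotient map. -/
def mk : TensorAlgebra ℂ (A × Γ) →ₐ[ℂ] Envelope C := RingQuot.mkAlgHom ℂ (EnvelopeRel C)

theorem mk_rel {x y : TensorAlgebra ℂ (A × Γ)} (h : EnvelopeRel C x y) : mk C x = mk C y :=
  RingQuot.mkAlgHom_rel ℂ h

/-- The inclusion of `A` as the part of degree zero. -/
def ofA : A →ₐ[ℂ] Envelope C :=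
  AlgHom.ofLinearMap ((mk C).toLinearMap ∘ₗ TensorAlgebra.ι ℂ ∘ₗ LinearMap.inl ℂ A Γ)
    (by simpa using mk_rel C EnvelopeRel.one)
    (fun a b => by simpa using (mk_rel C (EnvelopeRel.mul a b)).symm)

/-- The inclusion of `Γ` as the part of degree one. -/
def ofΓ : Γ →ₗ[ℂ] Envelope C :=
  (mk C).toLinearMap ∘ₗ TensorAlgebra.ι ℂ ∘ₗ LinearMap.inr ℂ A Γ

theorem ofA_mul_ofΓ (a : A) (γ : Γ) : ofA C a * ofΓ C γ = ofΓ C (a • γ) := by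
  simpa [ofA, ofΓ] using mk_rel C (EnvelopeRel.left a γ)

theorem ofΓ_mul_ofA (γ : Γ) (a : A) : ofΓ C γ * ofA C a = ofΓ C (op a • γ) := by
  simpa [ofA, ofΓ] using mk_rel C (EnvelopeRel.right γ a)

variable {R : Type*} [Ring R] [Algebra ℂ R]

/-- The map `a ⊗ b ↦ g(da) g(db)`. -/
def dd (g : Γ →ₗ[ℂ] R) : A ⊗[ℂ] A →ₗ[ℂ] R :=
  LinearMap.mul' ℂ R ∘ₗ TensorProduct.map (g ∘ₗ C.d) (g ∘ₗ C.d)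

@[simp] theorem dd_tmul (g : Γ →ₗ[ℂ] R) (a b : A) :
    dd C g (a ⊗ₜ b) = g (C.d a) * g (C.d b) := rfl

theorem exists_fin (t : A ⊗[ℂ] A) :
    ∃ (n : ℕ) (a b : Fin n → A), t = ∑ i, a i ⊗ₜ[ℂ] b i := by
  obtain ⟨S, rfl⟩ := TensorProduct.exists_finset t
  refine ⟨S.card, fun i => (S.equivFin.symm i).1.1, fun i => (S.equivFin.symm i).1.2, ?_⟩
  rw [← Finset.sum_coe_sort S]
  exact (Equiv.sum_comp S.equivFin.symm (fun i : S => i.1.1 ⊗ₜ[ℂ] i.1.2)).symm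

theorem dd_eq_zero (t : A ⊗[ℂ] A) (ht : C.toForm t = 0) : dd C (ofΓ C) t = 0 := by
  obtain ⟨n, a, b, rfl⟩ := exists_fin t
  have := mk_rel C (EnvelopeRel.diff n a b (by simpa using ht))
  simpa [ofΓ] using this

/-- Homomorphisms out of the envelope. -/
def lift (f : A →ₐ[ℂ] R) (g : Γ →ₗ[ℂ] R)
    (hl : ∀ a γ, f a * g γ = g (a • γ)) (hr : ∀ γ a, g γ * f a = g (op a • γ))
    (hd : ∀ t, C.toForm t = 0 → dd C g t = 0) : Envelope C →ₐ[ℂ] R :=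
  RingQuot.liftAlgHom ℂ ⟨TensorAlgebra.lift ℂ (f.toLinearMap.coprod g), by
    intro x y h
    induction h with
    | one => simp
    | mul a b => simp
    | left a γ => simpa using hl a γ
    | right γ a => simpa using hr γ a
    | diff n a b h =>
      have := hd (∑ i, a i ⊗ₜ b i) (by simpa using h)
      simpa using this⟩

section

variable (f : A →ₐ[ℂ] R) (g : Γ →ₗ[ℂ] R)
    (hl : ∀ a γ, f a * g γ = g (a • γ)) (hr : ∀ γ a, g γ * f a = g (op a • γ))
    (hd : ∀ t, C.toForm t = 0 → dd C g t = 0)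

@[simp] theorem lift_ofA (a : A) : lift C f g hl hr hd (ofA C a) = f a := by
  refine (RingQuot.liftAlgHom_mkAlgHom_apply ℂ _ _ _).trans ?_
  simp

@[simp] theorem lift_ofΓ (γ : Γ) : lift C f g hl hr hd (ofΓ C γ) = g γ := by
  refine (RingQuot.liftAlgHom_mkAlgHom_apply ℂ _ _ _).trans ?_
  simp

end

theorem algHom_ext {f g : Envelope C →ₐ[ℂ] R} (hA : ∀ a, f (ofA C a) = g (ofA C a))
    (hΓ : ∀ γ, f (ofΓ C γ) = g (ofΓ C γ)) : f = g := by
  refine RingQuot.ringQuot_ext' ℂ _ _ (TensorAlgebra.hom_ext ?_)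
  exact LinearMap.prod_ext (LinearMap.ext hA) (LinearMap.ext hΓ)

/-- The forms of degree `k`, spanned by the products `a γ₁ ⋯ γₖ`. -/
def grade (k : ℕ) : Submodule ℂ (Envelope C) :=
  LinearMap.range (ofA C).toLinearMap * LinearMap.range (ofΓ C) ^ k

theorem ofA_mem (a : A) : ofA C a ∈ grade C 0 := by
  have : ofA C a = ofA C a * 1 := (mul_one _).symm
  rw [this, grade, pow_zero]
  exact Submodule.mul_mem_mul ⟨a, rfl⟩ (Submodule.one_le.mp le_rfl)

theorem ofΓ_mem (γ : Γ) : ofΓ C γ ∈ grade C 1 := by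
  have : ofΓ C γ = ofA C 1 * ofΓ C γ := by rw [map_one, one_mul]
  rw [this, grade, pow_one]
  exact Submodule.mul_mem_mul ⟨1, rfl⟩ ⟨γ, rfl⟩

theorem range_ofΓ_pow_mul (k : ℕ) :
    LinearMap.range (ofΓ C) ^ k * LinearMap.range (ofA C).toLinearMap ≤ grade C k := by
  induction k with
  | zero =>
    rw [pow_zero, one_mul]
    rintro _ ⟨a, rfl⟩
    exact ofA_mem C a
  | succ k ih =>
    have h1 : LinearMap.range (ofΓ C) * LinearMap.range (ofA C).toLinearMap
        ≤ LinearMap.range (ofA C).toLinearMap * LinearMap.range (ofΓ C) := by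
      rw [Submodule.mul_le]
      rintro _ ⟨γ, rfl⟩ _ ⟨a, rfl⟩
      have : ofΓ C γ * ofA C a = ofA C 1 * ofΓ C (op a • γ) := by
        rw [ofΓ_mul_ofA, map_one, one_mul]
      exact this ▸ Submodule.mul_mem_mul ⟨1, rfl⟩ ⟨_, rfl⟩
    calc _ = LinearMap.range (ofΓ C) ^ k *
          (LinearMap.range (ofΓ C) * LinearMap.range (ofA C).toLinearMap) := by
            rw [pow_succ, mul_assoc]
      _ ≤ LinearMap.range (ofΓ C) ^ k *
          (LinearMap.range (ofA C).toLinearMap * LinearMap.range (ofΓ C)) :=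
            mul_le_mul_right h1 _
      _ ≤ grade C k * LinearMap.range (ofΓ C) := by
            rw [← mul_assoc]; exact mul_le_mul_left ih _
      _ = grade C (k + 1) := by rw [grade, grade, pow_succ, mul_assoc]

instance : SetLike.GradedMonoid (grade C) where
  one_mem := by simpa using ofA_mem C 1
  mul_mem := by
    intro i j x y hx hy
    have hAA : LinearMap.range (ofA C).toLinearMap * LinearMap.range (ofA C).toLinearMap
        ≤ LinearMap.range (ofA C).toLinearMap := by
      rw [Submodule.mul_le]
      rintro _ ⟨a, rfl⟩ _ ⟨b, rfl⟩
      exact ⟨a * b, by simp⟩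
    have h : grade C i * grade C j ≤ grade C (i + j) :=
      calc grade C i * grade C j
          = LinearMap.range (ofA C).toLinearMap * (LinearMap.range (ofΓ C) ^ i *
            LinearMap.range (ofA C).toLinearMap) * LinearMap.range (ofΓ C) ^ j := by
              simp only [grade, mul_assoc]
        _ ≤ LinearMap.range (ofA C).toLinearMap * grade C i * LinearMap.range (ofΓ C) ^ j :=
              mul_le_mul_left (mul_le_mul_right (range_ofΓ_pow_mul C i) _) _
        _ = LinearMap.range (ofA C).toLinearMap * LinearMap.range (ofA C).toLinearMap *
              LinearMap.range (ofΓ C) ^ (i + j) := by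
              simp only [grade, mul_assoc, pow_add]
        _ ≤ grade C (i + j) := mul_le_mul_left hAA _
    exact h (Submodule.mul_mem_mul hx hy)

/-- The inclusion of `A` in the direct sum of the homogeneous components. -/
def gradeA : A →ₐ[ℂ] ⨁ k, grade C k :=
  AlgHom.ofLinearMap
    (DirectSum.lof ℂ ℕ (fun k => grade C k) 0 ∘ₗ
      (ofA C).toLinearMap.codRestrict (grade C 0) (ofA_mem C))
    (by
      rw [DirectSum.one_def]
      exact congrArg (DirectSum.of (fun k => grade C k) 0) (Subtype.ext (map_one (ofA C))))
    (fun a b => by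
      refine Eq.trans ?_ (DirectSum.of_mul_of _ _).symm
      exact DirectSum.of_eq_of_gradedMonoid_eq
        (Sigma.subtype_ext (add_zero 0).symm (map_mul (ofA C) a b)))

/-- The inclusion of `Γ` in the direct sum of the homogeneous components. -/
def gradeΓ : Γ →ₗ[ℂ] ⨁ k, grade C k :=
  DirectSum.lof ℂ ℕ (fun k => grade C k) 1 ∘ₗ (ofΓ C).codRestrict (grade C 1) (ofΓ_mem C)

theorem gradeA_apply (a : A) : gradeA C a =
    DirectSum.of (fun k => grade C k) 0 ⟨ofA C a, ofA_mem C a⟩ := rfl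

theorem gradeΓ_apply (γ : Γ) : gradeΓ C γ =
    DirectSum.of (fun k => grade C k) 1 ⟨ofΓ C γ, ofΓ_mem C γ⟩ := rfl

theorem of_mul_of_eq {i j k : ℕ} (h : i + j = k) (x : grade C i) (y : grade C j) (z : grade C k)
    (hz : (x : Envelope C) * y = z) :
    DirectSum.of (fun k => grade C k) i x * DirectSum.of (fun k => grade C k) j y =
      DirectSum.of (fun k => grade C k) k z := by
  rw [DirectSum.of_mul_of]
  exact DirectSum.of_eq_of_gradedMonoid_eq (Sigma.subtype_ext h hz)

theorem ofΓ_mul_mem (γ γ' : Γ) : ofΓ C γ * ofΓ C γ' ∈ grade C 2 := by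
  have h := SetLike.mul_mem_graded (ofΓ_mem C γ) (ofΓ_mem C γ')
  rwa [one_add_one_eq_two] at h

theorem dd_gradeΓ (t : A ⊗[ℂ] A) : ∃ h : dd C (ofΓ C) t ∈ grade C 2,
    dd C (gradeΓ C) t = DirectSum.of (fun k => grade C k) 2 ⟨dd C (ofΓ C) t, h⟩ := by
  induction t with
  | zero =>
    refine ⟨by simp, ?_⟩
    rw [map_zero]
    exact (map_zero (DirectSum.of (fun k => grade C k) 2)).symm.trans
      (congrArg _ (Subtype.ext (map_zero _).symm))
  | tmul a b =>
    refine ⟨ofΓ_mul_mem C _ _, ?_⟩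
    rw [dd_tmul, gradeΓ_apply, gradeΓ_apply]
    exact of_mul_of_eq C one_add_one_eq_two _ _ _ rfl
  | add x y hx hy =>
    obtain ⟨h1, e1⟩ := hx
    obtain ⟨h2, e2⟩ := hy
    refine ⟨by rw [map_add]; exact add_mem h1 h2, ?_⟩
    rw [map_add, e1, e2, ← map_add]
    exact congrArg _ (Subtype.ext (map_add _ _ _).symm)

/-- The decomposition of a form into its homogeneous components. -/
def decomposition : Envelope C →ₐ[ℂ] ⨁ k, grade C k :=
  lift (R := ⨁ k, grade C k) C (gradeA C) (gradeΓ C)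
    (fun a γ => by
      rw [gradeA_apply, gradeΓ_apply, gradeΓ_apply]
      exact of_mul_of_eq C (zero_add 1) _ _ _ (ofA_mul_ofΓ C a γ))
    (fun γ a => by
      rw [gradeA_apply, gradeΓ_apply, gradeΓ_apply]
      exact of_mul_of_eq C (add_zero 1) _ _ _ (ofΓ_mul_ofA C γ a))
    (fun t ht => by
      obtain ⟨h, e⟩ := dd_gradeΓ C t
      rw [e]
      refine (congrArg _ (Subtype.ext ?_)).trans
        (map_zero (DirectSum.of (fun k => grade C k) 2))
      exact dd_eq_zero C t ht)

theorem decomposition_ofA (a : A) : decomposition C (ofA C a) =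
    DirectSum.of (fun k => grade C k) 0 ⟨ofA C a, ofA_mem C a⟩ :=
  lift_ofA C _ _ _ _ _ a

theorem decomposition_ofΓ (γ : Γ) : decomposition C (ofΓ C γ) =
    DirectSum.of (fun k => grade C k) 1 ⟨ofΓ C γ, ofΓ_mem C γ⟩ :=
  lift_ofΓ C _ _ _ _ _ γ

instance : GradedAlgebra (grade C) :=
  GradedAlgebra.ofAlgHom (grade C) (decomposition C)
    (by
      refine algHom_ext C (fun a => ?_) (fun γ => ?_)
      · rw [AlgHom.comp_apply, decomposition_ofA]
        exact DirectSum.coeAlgHom_of _ _ _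
      · rw [AlgHom.comp_apply, decomposition_ofΓ]
        exact DirectSum.coeAlgHom_of _ _ _)
    (by
      have hpow : ∀ (k : ℕ) (x : Envelope C), x ∈ LinearMap.range (ofΓ C) ^ k →
          ∃ h : x ∈ grade C k, decomposition C x = DirectSum.of (fun k => grade C k) k ⟨x, h⟩ := by
        intro k x hx
        induction hx using Submodule.pow_induction_on_left' with
        | algebraMap r =>
          refine ⟨by simpa using ofA_mem C (algebraMap ℂ A r), ?_⟩
          rw [AlgHom.commutes, DirectSum.algebraMap_apply]
          rfl
        | add x y i hx hy ihx ihy =>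
          obtain ⟨h1, e1⟩ := ihx
          obtain ⟨h2, e2⟩ := ihy
          refine ⟨add_mem h1 h2, ?_⟩
          rw [map_add, e1, e2, ← map_add]
          rfl
        | mem_mul m hm i x hx ih =>
          obtain ⟨γ, rfl⟩ := hm
          obtain ⟨h, e⟩ := ih
          have hm : ofΓ C γ * x ∈ grade C (i + 1) := by
            rw [add_comm]; exact SetLike.mul_mem_graded (ofΓ_mem C γ) h
          refine ⟨hm, ?_⟩
          rw [map_mul, e, decomposition_ofΓ]
          exact of_mul_of_eq C (add_comm 1 i) _ _ _ rfl
      rintro k ⟨x, hx⟩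
      suffices ∃ h : x ∈ grade C k,
          decomposition C x = DirectSum.of (fun k => grade C k) k ⟨x, h⟩ from this.2
      induction hx using Submodule.mul_induction_on' with
      | mem_mul_mem m hm n hn =>
        obtain ⟨a, rfl⟩ := hm
        obtain ⟨h, e⟩ := hpow k n hn
        have hm : ofA C a * n ∈ grade C k := by
          simpa using SetLike.mul_mem_graded (ofA_mem C a) h
        refine ⟨hm, ?_⟩
        refine (map_mul _ _ _).trans ?_
        rw [e]
        refine (congrArg (· * _) (decomposition_ofA C a)).trans ?_
        exact of_mul_of_eq C (zero_add k) _ _ _ rfl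
      | add x hx y hy ihx ihy =>
        obtain ⟨h1, e1⟩ := ihx
        obtain ⟨h2, e2⟩ := ihy
        refine ⟨add_mem h1 h2, ?_⟩
        rw [map_add, e1, e2, ← map_add]
        rfl)

/-- The differential of one-forms, `a d(b) ↦ d(a) d(b)`. -/
def dOne : Γ →ₗ[ℂ] Envelope C := C.desc (dd C (ofΓ C)) (dd_eq_zero C)

theorem dOne_smul_d (a b : A) : dOne C (a • C.d b) = ofΓ C (C.d a) * ofΓ C (C.d b) :=
  C.desc_smul_d _ _ a b

theorem dOne_smul (a : A) (γ : Γ) :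
    dOne C (a • γ) = ofΓ C (C.d a) * ofΓ C γ + ofA C a * dOne C γ := by
  induction γ using C.induction with
  | h b c =>
    rw [← mul_smul, dOne_smul_d, dOne_smul_d, C.leibniz, map_add, add_mul, ← ofA_mul_ofΓ,
      ← ofΓ_mul_ofA, mul_assoc, mul_assoc, ofA_mul_ofΓ C b, add_comm]
  | hadd x y hx hy => simp only [smul_add, map_add, hx, hy, mul_add]; abel

theorem dOne_op_smul (γ : Γ) (a : A) :
    dOne C (op a • γ) = dOne C γ * ofA C a - ofΓ C γ * ofΓ C (C.d a) := by
  induction γ using C.induction with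
  | h b c =>
    rw [C.op_smul_smul_d, map_sub, dOne_smul_d, dOne_smul_d, dOne_smul_d, C.leibniz, C.leibniz,
      map_add, map_add, mul_add, add_mul, ← ofA_mul_ofΓ, ← ofA_mul_ofΓ, ← ofΓ_mul_ofA,
      ← ofΓ_mul_ofA]
    simp only [mul_assoc]
    abel
  | hadd x y hx hy => simp only [smul_add, map_add, hx, hy, add_mul]; abel

/-- The map `a ↦ (a, da; 0, a)` into matrices. -/
def matA : A →ₐ[ℂ] Matrix (Fin 2) (Fin 2) (Envelope C) where
  toFun a := !![ofA C a, ofΓ C (C.d a); 0, ofA C a]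
  map_one' := by
    ext i j; fin_cases i <;> fin_cases j <;> simp [C.d_one]
  map_mul' a b := by
    ext i j; fin_cases i <;> fin_cases j <;>
      simp [Matrix.mul_apply, Fin.sum_univ_two, C.leibniz, ofA_mul_ofΓ, ofΓ_mul_ofA]
  map_zero' := by ext i j; fin_cases i <;> fin_cases j <;> simp
  map_add' a b := by ext i j; fin_cases i <;> fin_cases j <;> simp
  commutes' r := by
    have : C.d (algebraMap ℂ A r) = 0 := by
      rw [Algebra.algebraMap_eq_smul_one, map_smul, C.d_one, smul_zero]
    ext i j; fin_cases i <;> fin_cases j <;> simp [this, Matrix.algebraMap_matrix_apply]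

/-- The map `γ ↦ (-γ, dγ; 0, γ)` into matrices. -/
def matΓ : Γ →ₗ[ℂ] Matrix (Fin 2) (Fin 2) (Envelope C) where
  toFun γ := !![-ofΓ C γ, dOne C γ; 0, ofΓ C γ]
  map_add' a b := by ext i j; fin_cases i <;> fin_cases j <;> simp [add_comm]
  map_smul' r a := by ext i j; fin_cases i <;> fin_cases j <;> simp

theorem dOne_d (a : A) : dOne C (C.d a) = 0 := by
  have := dOne_smul_d C 1 a
  simpa [C.d_one] using this

theorem dd_matΓ (t : A ⊗[ℂ] A) :
    dd C (matΓ C) t = !![dd C (ofΓ C) t, 0; 0, dd C (ofΓ C) t] := by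
  induction t with
  | zero => ext i j; fin_cases i <;> fin_cases j <;> simp
  | tmul a b =>
    ext i j; fin_cases i <;> fin_cases j <;>
      simp [matΓ, dOne_d, Matrix.mul_apply, Fin.sum_univ_two]
  | add x y hx hy =>
    rw [map_add, hx, hy]
    ext i j; fin_cases i <;> fin_cases j <;> simp

/-- The homomorphism `w ↦ ((-1)^∂w w, dw; 0, w)`, which encodes the graded Leibniz rule. -/
def mat : Envelope C →ₐ[ℂ] Matrix (Fin 2) (Fin 2) (Envelope C) :=
  lift C (matA C) (matΓ C)
    (fun a γ => by
      ext i j; fin_cases i <;> fin_cases j <;>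
        simp [matA, matΓ, Matrix.mul_apply, Fin.sum_univ_two, ofA_mul_ofΓ, dOne_smul, add_comm])
    (fun γ a => by
      ext i j; fin_cases i <;> fin_cases j <;>
        simp [matA, matΓ, Matrix.mul_apply, Fin.sum_univ_two, ofΓ_mul_ofA, dOne_op_smul,
          sub_eq_add_neg, add_comm])
    (fun t ht => by
      rw [dd_matΓ, dd_eq_zero C t ht]
      ext i j; fin_cases i <;> fin_cases j <;> simp)

/-- The differential of the envelope: the graded derivation that extends `d : A → Γ` and sends
`a d(b)` to `d(a) d(b)`. -/
def d : Envelope C →ₗ[ℂ] Envelope C :=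
  Matrix.entryLinearMap ℂ (Envelope C) (0 : Fin 2) (1 : Fin 2) ∘ₗ (mat C).toLinearMap

@[simp] theorem d_ofA (a : A) : d C (ofA C a) = ofΓ C (C.d a) := by
  simp [d, mat, matA]

@[simp] theorem d_ofΓ (γ : Γ) : d C (ofΓ C γ) = dOne C γ := by
  simp [d, mat, matΓ]

/-- The projection onto the part of degree zero. -/
def p₀ : Envelope C →ₐ[ℂ] A :=
  lift C (AlgHom.id ℂ A) 0 (by simp) (by simp) (fun t _ => by simp [dd])

end Envelope
end Envelope

/-! ### Bicovariant `*`-calculi -/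

section Bicovariant

variable {A Γ : Type*} [Ring A] [HopfAlgebra ℂ A]
  [AddCommGroup Γ] [Module ℂ Γ] [Module A Γ] [Module Aᵐᵒᵖ Γ] [SMulCommClass A Aᵐᵒᵖ Γ]
  [IsScalarTower ℂ A Γ] [IsScalarTower ℂ Aᵐᵒᵖ Γ]

namespace FirstOrderCalculus

variable (C : FirstOrderCalculus A Γ)

/-- The map `(x ⊗ y, z ⊗ w) ↦ x z ⊗ y d(w)`. -/
def leftPair : A ⊗[ℂ] A →ₗ[ℂ] A ⊗[ℂ] A →ₗ[ℂ] A ⊗[ℂ] Γ :=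
  TensorProduct.map₂ (LinearMap.mul ℂ A) ((Algebra.lsmul ℂ ℂ Γ).toLinearMap.compl₂ C.d)

/-- The map `(x ⊗ y, z ⊗ w) ↦ x d(z) ⊗ y w`. -/
def rightPair : A ⊗[ℂ] A →ₗ[ℂ] A ⊗[ℂ] A →ₗ[ℂ] Γ ⊗[ℂ] A :=
  TensorProduct.map₂ ((Algebra.lsmul ℂ ℂ Γ).toLinearMap.compl₂ C.d) (LinearMap.mul ℂ A)

@[simp] theorem leftPair_tmul (x y z w : A) :
    C.leftPair (x ⊗ₜ y) (z ⊗ₜ w) = (x * z) ⊗ₜ (y • C.d w) := rfl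

@[simp] theorem rightPair_tmul (x y z w : A) :
    C.rightPair (x ⊗ₜ y) (z ⊗ₜ w) = (x • C.d z) ⊗ₜ (y * w) := rfl

/-- The map `a ⊗ b ↦ φ(a) (id ⊗ d)φ(b)`, where `φ` is the comultiplication. -/
def leftMap : A ⊗[ℂ] A →ₗ[ℂ] A ⊗[ℂ] Γ :=
  TensorProduct.lift (C.leftPair.compl₁₂ Coalgebra.comul Coalgebra.comul)

/-- The map `a ⊗ b ↦ φ(a) (d ⊗ id)φ(b)`, where `φ` is the comultiplication. -/
def rightMap : A ⊗[ℂ] A →ₗ[ℂ] Γ ⊗[ℂ] A :=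
  TensorProduct.lift (C.rightPair.compl₁₂ Coalgebra.comul Coalgebra.comul)

@[simp] theorem leftMap_tmul (a b : A) : C.leftMap (a ⊗ₜ b) =
    C.leftPair (Coalgebra.comul (R := ℂ) a) (Coalgebra.comul (R := ℂ) b) := rfl

@[simp] theorem rightMap_tmul (a b : A) : C.rightMap (a ⊗ₜ b) =
    C.rightPair (Coalgebra.comul (R := ℂ) a) (Coalgebra.comul (R := ℂ) b) := rfl

end FirstOrderCalculus

variable (A Γ) in
/-- A bicovariant first-order `*`-calculus: for all finite families, `∑ aᵢ d(bᵢ) = 0` implies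
`∑ φ(aᵢ) (id ⊗ d)φ(bᵢ) = 0` (left covariance) and `∑ φ(aᵢ) (d ⊗ id)φ(bᵢ) = 0` (right covariance),
and `Γ` carries an antilinear involution with `(a d(b))^* = d(b^*) a^*`. -/
structure BicovariantStarCalculus [StarRing A] [StarAddMonoid Γ] [StarModule ℂ Γ]
    extends FirstOrderCalculus A Γ where
  left_covariant : ∀ t, toFirstOrderCalculus.toForm t = 0 → toFirstOrderCalculus.leftMap t = 0
  right_covariant : ∀ t, toFirstOrderCalculus.toForm t = 0 → toFirstOrderCalculus.rightMap t = 0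
  star_smul_d : ∀ a b : A, star (a • d b) = op (star a) • d (star b)

namespace BicovariantStarCalculus

variable [StarRing A] [StarModule ℂ A] [StarAddMonoid Γ] [StarModule ℂ Γ]
  (C : BicovariantStarCalculus A Γ)

/-- The left action `ℓ : Γ → A ⊗ Γ`, `ℓ(a d(b)) = φ(a) (id ⊗ d)φ(b)`. -/
def leftCoaction : Γ →ₗ[ℂ] A ⊗[ℂ] Γ := C.desc C.leftMap C.left_covariant

/-- The right action `℘ : Γ → Γ ⊗ A`, `℘(a d(b)) = φ(a) (d ⊗ id)φ(b)`. -/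
def rightCoaction : Γ →ₗ[ℂ] Γ ⊗[ℂ] A := C.desc C.rightMap C.right_covariant

theorem leftCoaction_smul_d (a b : A) : C.leftCoaction (a • C.d b) =
    C.leftPair (Coalgebra.comul (R := ℂ) a) (Coalgebra.comul (R := ℂ) b) :=
  C.desc_smul_d _ _ a b

theorem rightCoaction_smul_d (a b : A) : C.rightCoaction (a • C.d b) =
    C.rightPair (Coalgebra.comul (R := ℂ) a) (Coalgebra.comul (R := ℂ) b) :=
  C.desc_smul_d _ _ a b

/-- The space `Γ_inv` of left-invariant elements, `ℓ(ϑ) = 1 ⊗ ϑ`. -/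
def inv : Submodule ℂ Γ :=
  LinearMap.ker (C.leftCoaction - TensorProduct.mk ℂ A Γ 1)

theorem mem_inv {γ : Γ} : γ ∈ C.inv ↔ C.leftCoaction γ = 1 ⊗ₜ γ := by
  simp [inv, sub_eq_zero]

theorem star_leftPair (x y : A ⊗[ℂ] A) : star (C.leftPair x y) =
    TensorProduct.map LinearMap.id C.d (star y * star x) -
      C.leftPair (star y) (star x) := by
  induction x with
  | zero => simp
  | add x x' hx hx' => simp only [map_add, LinearMap.add_apply, star_add, hx, hx', mul_add]; abel
  | tmul a b =>
    induction y with
    | zero => simp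
    | add x x' hx hx' => simp only [map_add, LinearMap.add_apply, star_add, hx, hx', add_mul]; abel
    | tmul c e =>
      simp [C.star_smul_d, C.leibniz, TensorProduct.tmul_add]

theorem leftCoaction_star [IsCompactMatrixQuantumGroup A] (γ : Γ) : C.leftCoaction (star γ) = star (C.leftCoaction γ) := by
  induction γ using C.induction with
  | hadd x y hx hy => simp only [star_add, map_add, hx, hy]
  | h a b =>
    have hd : ∀ c : A, C.leftCoaction (C.d c) =
        TensorProduct.map LinearMap.id C.d (Coalgebra.comul (R := ℂ) c) := by
      intro c
      have := C.leftCoaction_smul_d 1 c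
      rw [one_smul] at this
      rw [this, Bialgebra.comul_one]
      generalize Coalgebra.comul (R := ℂ) c = x
      induction x with
      | zero => simp
      | tmul x y => simp [Algebra.TensorProduct.one_def]
      | add x y hx hy => rw [map_add, map_add, hx, hy]
    have h1 := C.op_smul_smul_d 1 (star b) (star a)
    rw [one_smul, one_smul, one_mul] at h1
    rw [C.star_smul_d, h1, map_sub, hd, leftCoaction_smul_d, leftCoaction_smul_d, star_leftPair,
      Bialgebra.comul_mul, IsCompactMatrixQuantumGroup.comul_star,
      IsCompactMatrixQuantumGroup.comul_star]

theorem star_mem_inv [IsCompactMatrixQuantumGroup A] {γ : Γ} (h : γ ∈ C.inv) : star γ ∈ C.inv := by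
  rw [mem_inv] at h ⊢
  rw [leftCoaction_star, h]
  simp

/-- The `*`-involution of `Γ_inv`. -/
instance [IsCompactMatrixQuantumGroup A] : Star C.inv := ⟨fun ϑ => ⟨star (ϑ : Γ), C.star_mem_inv ϑ.2⟩⟩

/-- The map `(x ⊗ y ⊗ z, x' ⊗ y' ⊗ z') ↦ x x' ⊗ y d(y') ⊗ z z'`. -/
def midPair : A ⊗[ℂ] (A ⊗[ℂ] A) →ₗ[ℂ] A ⊗[ℂ] (A ⊗[ℂ] A) →ₗ[ℂ] A ⊗[ℂ] (Γ ⊗[ℂ] A) :=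
  TensorProduct.map₂ (LinearMap.mul ℂ A) C.rightPair

theorem assoc_leftCoaction_rightPair (x y : A ⊗[ℂ] A) :
    TensorProduct.assoc ℂ A Γ A (TensorProduct.map C.leftCoaction LinearMap.id (C.rightPair x y)) =
      C.midPair (TensorProduct.assoc ℂ A A A (Coalgebra.comul.rTensor A x))
        (TensorProduct.assoc ℂ A A A (Coalgebra.comul.rTensor A y)) := by
  induction x with
  | zero => simp
  | add x x' hx hx' => simp only [map_add, LinearMap.add_apply, hx, hx']
  | tmul a b =>
    induction y with
    | zero => simp
    | add x x' hx hx' => simp only [map_add, hx, hx']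
    | tmul c e =>
      rw [C.rightPair_tmul, TensorProduct.map_tmul, leftCoaction_smul_d, LinearMap.rTensor_tmul,
        LinearMap.rTensor_tmul]
      generalize Coalgebra.comul (R := ℂ) a = u
      generalize Coalgebra.comul (R := ℂ) c = v
      induction u with
      | zero => simp
      | add x x' hx hx' =>
        simp only [map_add, LinearMap.add_apply, TensorProduct.add_tmul, hx, hx']
      | tmul p q =>
        induction v with
        | zero => simp
        | add x x' hx hx' => simp only [map_add, TensorProduct.add_tmul, hx, hx']
        | tmul r s => simp [midPair]

theorem rightCoaction_leftPair (x y : A ⊗[ℂ] A) :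
    TensorProduct.map LinearMap.id C.rightCoaction (C.leftPair x y) =
      C.midPair (Coalgebra.comul.lTensor A x) (Coalgebra.comul.lTensor A y) := by
  induction x with
  | zero => simp
  | add x x' hx hx' => simp only [map_add, LinearMap.add_apply, hx, hx']
  | tmul a b =>
    induction y with
    | zero => simp
    | add x x' hx hx' => simp only [map_add, hx, hx']
    | tmul c e => simp [midPair, rightCoaction_smul_d]

theorem coaction_comm (γ : Γ) :
    TensorProduct.assoc ℂ A Γ A (TensorProduct.map C.leftCoaction LinearMap.id (C.rightCoaction γ))
      = TensorProduct.map LinearMap.id C.rightCoaction (C.leftCoaction γ) := by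
  induction γ using C.induction with
  | hadd x y hx hy => simp only [map_add, hx, hy]
  | h a b =>
    rw [rightCoaction_smul_d, leftCoaction_smul_d, assoc_leftCoaction_rightPair,
      rightCoaction_leftPair, Coalgebra.coassoc_apply, Coalgebra.coassoc_apply]

theorem rightCoaction_mem (ϑ : C.inv) :
    C.rightCoaction ϑ ∈ LinearMap.range (C.inv.subtype.rTensor A) := by
  have hex : Function.Exact C.inv.subtype (C.leftCoaction - TensorProduct.mk ℂ A Γ 1) :=
    LinearMap.exact_subtype_ker_map _
  rw [← (Module.Flat.rTensor_exact A hex).linearMap_ker_eq, LinearMap.mem_ker]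
  have h := C.coaction_comm ϑ
  rw [C.mem_inv.mp ϑ.2, TensorProduct.map_tmul] at h
  have h2 : ∀ t : Γ ⊗[ℂ] A, TensorProduct.assoc ℂ A Γ A
      ((TensorProduct.mk ℂ A Γ 1).rTensor A t) = 1 ⊗ₜ t := by
    intro t
    induction t with
    | zero => simp
    | add x y hx hy => simp only [map_add, TensorProduct.tmul_add, hx, hy]
    | tmul x y => simp
  rw [LinearMap.rTensor_sub]
  refine (sub_eq_zero (G := (A ⊗[ℂ] Γ) ⊗[ℂ] A)).mpr ?_
  apply (TensorProduct.assoc ℂ A Γ A).injective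
  rw [h2]
  exact h

theorem rTensor_subtype_injective : Function.Injective (C.inv.subtype.rTensor A) :=
  Module.Flat.rTensor_preserves_injective_linearMap _ Subtype.val_injective

/-- The adjoint action `ϖ : Γ_inv → Γ_inv ⊗ A`, the restriction of the right action `℘`. -/
def adjointCoaction : C.inv →ₗ[ℂ] C.inv ⊗[ℂ] A :=
  (LinearEquiv.ofInjective _ C.rTensor_subtype_injective).symm.toLinearMap ∘ₗ
    (C.rightCoaction ∘ₗ C.inv.subtype).codRestrict _ C.rightCoaction_mem

theorem adjointCoaction_spec (ϑ : C.inv) :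
    C.inv.subtype.rTensor A (C.adjointCoaction ϑ) = C.rightCoaction ϑ :=
  congrArg Subtype.val ((LinearEquiv.ofInjective _ C.rTensor_subtype_injective).apply_symm_apply
    ⟨C.rightCoaction ϑ, C.rightCoaction_mem ϑ⟩)

/-- The universal differential envelope `Γ^∧` of the calculus. -/
abbrev Env : Type _ := Envelope C.toFirstOrderCalculus

/-- The homomorphism `A → A ⊗ Γ^∧` induced by the comultiplication. -/
def envLeftA : A →ₐ[ℂ] A ⊗[ℂ] C.Env :=
  (Algebra.TensorProduct.map (AlgHom.id ℂ A) (Envelope.ofA C.toFirstOrderCalculus)).comp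
    (Bialgebra.comulAlgHom ℂ A)

/-- The map `Γ → A ⊗ Γ^∧` induced by the left action. -/
def envLeftΓ : Γ →ₗ[ℂ] A ⊗[ℂ] C.Env :=
  TensorProduct.map LinearMap.id (Envelope.ofΓ C.toFirstOrderCalculus) ∘ₗ C.leftCoaction

theorem map_ofΓ_leftPair (x y : A ⊗[ℂ] A) :
    TensorProduct.map LinearMap.id (Envelope.ofΓ C.toFirstOrderCalculus) (C.leftPair x y) =
      Algebra.TensorProduct.map (AlgHom.id ℂ A) (Envelope.ofA C.toFirstOrderCalculus) x *
        TensorProduct.map LinearMap.id (Envelope.ofΓ C.toFirstOrderCalculus ∘ₗ C.d) y := by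
  induction x with
  | zero => simp
  | add x x' hx hx' => simp only [map_add, LinearMap.add_apply, hx, hx', add_mul]
  | tmul a b =>
    induction y with
    | zero => simp
    | add x x' hx hx' => simp only [map_add, hx, hx', mul_add]
    | tmul c e => simp [Envelope.ofA_mul_ofΓ]

theorem envLeftΓ_smul_d (a b : A) : C.envLeftΓ (a • C.d b) =
    C.envLeftA a * TensorProduct.map LinearMap.id (Envelope.ofΓ C.toFirstOrderCalculus ∘ₗ C.d)
      (Coalgebra.comul (R := ℂ) b) := by
  simp only [envLeftΓ, LinearMap.comp_apply, leftCoaction_smul_d, map_ofΓ_leftPair]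
  rfl

theorem envLeftΓ_d (b : A) : C.envLeftΓ (C.d b) =
    TensorProduct.map LinearMap.id (Envelope.ofΓ C.toFirstOrderCalculus ∘ₗ C.d)
      (Coalgebra.comul (R := ℂ) b) := by
  have := C.envLeftΓ_smul_d 1 b
  rwa [one_smul, map_one, one_mul] at this

theorem map_ofΓ_d_mul (x y : A ⊗[ℂ] A) :
    TensorProduct.map LinearMap.id (Envelope.ofΓ C.toFirstOrderCalculus ∘ₗ C.d) (x * y) =
      Algebra.TensorProduct.map (AlgHom.id ℂ A) (Envelope.ofA C.toFirstOrderCalculus) x *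
        TensorProduct.map LinearMap.id (Envelope.ofΓ C.toFirstOrderCalculus ∘ₗ C.d) y +
      TensorProduct.map LinearMap.id (Envelope.ofΓ C.toFirstOrderCalculus ∘ₗ C.d) x *
        Algebra.TensorProduct.map (AlgHom.id ℂ A) (Envelope.ofA C.toFirstOrderCalculus) y := by
  induction x with
  | zero => simp
  | add x x' hx hx' => simp only [map_add, hx, hx', add_mul]; abel
  | tmul a b =>
    induction y with
    | zero => simp
    | add x x' hx hx' => simp only [map_add, hx, hx', mul_add]; abel
    | tmul c e =>
      simp [C.leibniz, Envelope.ofA_mul_ofΓ, Envelope.ofΓ_mul_ofA, TensorProduct.tmul_add]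

theorem envLeft_left (a : A) (γ : Γ) : C.envLeftA a * C.envLeftΓ γ = C.envLeftΓ (a • γ) := by
  induction γ using C.induction with
  | hadd x y hx hy => simp only [map_add, smul_add, mul_add, hx, hy]
  | h b c => rw [← mul_smul, envLeftΓ_smul_d, envLeftΓ_smul_d, map_mul, mul_assoc]

theorem envLeft_right (γ : Γ) (a : A) :
    C.envLeftΓ γ * C.envLeftA a = C.envLeftΓ (op a • γ) := by
  induction γ using C.induction with
  | hadd x y hx hy => simp only [map_add, smul_add, add_mul, hx, hy]
  | h b c =>
    rw [C.op_smul_smul_d, map_sub, envLeftΓ_smul_d, envLeftΓ_smul_d, envLeftΓ_smul_d,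
      Bialgebra.comul_mul, map_ofΓ_d_mul, map_mul]
    simp only [mul_add, mul_assoc]
    exact (add_sub_cancel_left _ _).symm

theorem map_dOne_leftPair (x y : A ⊗[ℂ] A) :
    TensorProduct.map LinearMap.id (Envelope.dOne C.toFirstOrderCalculus) (C.leftPair x y) =
      TensorProduct.map LinearMap.id (Envelope.ofΓ C.toFirstOrderCalculus ∘ₗ C.d) x *
        TensorProduct.map LinearMap.id (Envelope.ofΓ C.toFirstOrderCalculus ∘ₗ C.d) y := by
  induction x with
  | zero => simp
  | add x x' hx hx' => simp only [map_add, LinearMap.add_apply, hx, hx', add_mul]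
  | tmul a b =>
    induction y with
    | zero => simp
    | add x x' hx hx' => simp only [map_add, hx, hx', mul_add]
    | tmul c e => simp [Envelope.dOne_smul_d]

theorem dd_envLeftΓ (t : A ⊗[ℂ] A) : Envelope.dd C.toFirstOrderCalculus C.envLeftΓ t =
    TensorProduct.map LinearMap.id (Envelope.dOne C.toFirstOrderCalculus) (C.leftMap t) := by
  induction t with
  | zero => simp
  | add x y hx hy => simp only [map_add, hx, hy]
  | tmul a b => rw [Envelope.dd_tmul, envLeftΓ_d, envLeftΓ_d, C.leftMap_tmul, map_dOne_leftPair]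

/-- The left action `ℓ^∧ : Γ^∧ → A ⊗ Γ^∧`, the homomorphism that extends the comultiplication of
`A` and the left action `ℓ` on `Γ`. -/
def envLeftCoaction : C.Env →ₐ[ℂ] A ⊗[ℂ] C.Env :=
  Envelope.lift C.toFirstOrderCalculus C.envLeftA C.envLeftΓ C.envLeft_left C.envLeft_right
    (fun t ht => by rw [dd_envLeftΓ, C.left_covariant t ht, map_zero])

/-- The canonical projection `π_inv` of `Γ^∧` onto the left-invariant forms,
`w ↦ κ(w₍₋₁₎) w₍₀₎` where `ℓ^∧(w) = w₍₋₁₎ ⊗ w₍₀₎` and `κ` is the antipode; in terms of the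
factorization of `Γ^∧` as `A ⊗ Γ^∧_inv` it is `ε ⊗ id`. -/
def invProj : C.Env →ₗ[ℂ] C.Env :=
  LinearMap.mul' ℂ C.Env ∘ₗ
    TensorProduct.map ((Envelope.ofA C.toFirstOrderCalculus).toLinearMap ∘ₗ
      HopfAlgebra.antipode ℂ) LinearMap.id ∘ₗ C.envLeftCoaction.toLinearMap

end BicovariantStarCalculus
end Bicovariant

/-! ### Quantum principal bundles -/

section Bundle

variable (A V B : Type*) [Ring A] [StarRing A] [HopfAlgebra ℂ A] [StarModule ℂ A]
  [Ring V] [StarRing V] [Algebra ℂ V] [StarModule ℂ V]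
  [Ring B] [StarRing B] [Algebra ℂ B] [StarModule ℂ B]

/-- A quantum principal bundle `(B, i, F)` over the quantum space with the unital `*`-algebra `V`,
with the structure group given by the Hopf `*`-algebra `A`. -/
structure QuantumPrincipalBundle where
  i : V →⋆ₐ[ℂ] B
  F : B →⋆ₐ[ℂ] B ⊗[ℂ] A
  i_injective : Function.Injective i
  mem_range_iff : ∀ b : B, b ∈ Set.range i ↔ F b = b ⊗ₜ 1
  counit : ∀ b : B, TensorProduct.rid ℂ B (Coalgebra.counit.lTensor B (F b)) = b
  coassoc : ∀ b : B, Coalgebra.comul.lTensor B (F b) =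
    TensorProduct.assoc ℂ B A A (TensorProduct.map F.toAlgHom.toLinearMap LinearMap.id (F b))
  /-- The map `q ⊗ b ↦ q F(b)` is surjective. -/
  free : Function.Surjective (TensorProduct.lift
    ((LinearMap.mul ℂ (B ⊗[ℂ] A)).compl₁₂ ((TensorProduct.mk ℂ B A).flip 1)
      F.toAlgHom.toLinearMap) : B ⊗[ℂ] B →ₗ[ℂ] B ⊗[ℂ] A)

end Bundle

/-! ### Differential calculus on the bundle -/

section GradedDifferential

variable {Ω : Type*} [Ring Ω] [Algebra ℂ Ω] (𝒢 : ℕ → Submodule ℂ Ω) [GradedAlgebra 𝒢]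

/-- A graded-differential `*`-algebra: `d` is a hermitian differential of degree one that satisfies
the graded Leibniz rule, and `*` is an antilinear graded-antimultiplicative involution that
preserves degrees. -/
structure GradedDifferentialStarAlgebra [StarAddMonoid Ω] [StarModule ℂ Ω] where
  d : Ω →ₗ[ℂ] Ω
  d_mem : ∀ k, ∀ w ∈ 𝒢 k, d w ∈ 𝒢 (k + 1)
  d_d : ∀ w, d (d w) = 0
  d_mul : ∀ k, ∀ w ∈ 𝒢 k, ∀ u, d (w * u) = d w * u + (-1 : ℂ) ^ k • (w * d u)
  star_mem : ∀ k, ∀ w ∈ 𝒢 k, star w ∈ 𝒢 k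
  star_mul : ∀ k l, ∀ w ∈ 𝒢 k, ∀ u ∈ 𝒢 l,
    star (w * u) = (-1 : ℂ) ^ (k * l) • (star u * star w)
  d_star : ∀ w, d (star w) = star (d w)

/-- The linear map `w ↦ (-1)^k w` for `w` of degree `k`. -/
def gradeSign : Ω →ₗ[ℂ] Ω :=
  DirectSum.toModule ℂ ℕ Ω (fun k => (-1 : ℂ) ^ k • (𝒢 k).subtype) ∘ₗ
    (DirectSum.decomposeLinearEquiv 𝒢).toLinearMap

theorem gradeSign_apply {k : ℕ} {w : Ω} (hw : w ∈ 𝒢 k) :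
    gradeSign 𝒢 w = (-1 : ℂ) ^ k • w := by
  lift w to 𝒢 k using hw
  simp [gradeSign]

/-- The differential `w ⊗ u ↦ dw ⊗ u + (-1)^∂w w ⊗ du` of a graded tensor product. -/
def tensorDifferential {Λ : Type*} [Ring Λ] [Algebra ℂ Λ] (dΩ : Ω →ₗ[ℂ] Ω) (dΛ : Λ →ₗ[ℂ] Λ) :
    Ω ⊗[ℂ] Λ →ₗ[ℂ] Ω ⊗[ℂ] Λ :=
  TensorProduct.map dΩ LinearMap.id + TensorProduct.map (gradeSign 𝒢) dΛ

/-- The component of degree zero. -/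
def zeroPart : Ω →ₗ[ℂ] 𝒢 0 :=
  DirectSum.component ℂ ℕ (fun k => 𝒢 k) 0 ∘ₗ (DirectSum.decomposeLinearEquiv 𝒢).toLinearMap

end GradedDifferential

section BundleCalculus

variable {A Γ V B Ω : Type*} [Ring A] [StarRing A] [HopfAlgebra ℂ A] [StarModule ℂ A]
  [AddCommGroup Γ] [Module ℂ Γ] [Module A Γ] [Module Aᵐᵒᵖ Γ] [SMulCommClass A Aᵐᵒᵖ Γ]
  [IsScalarTower ℂ A Γ] [IsScalarTower ℂ Aᵐᵒᵖ Γ] [StarAddMonoid Γ] [StarModule ℂ Γ]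
  [Ring V] [StarRing V] [Algebra ℂ V] [StarModule ℂ V]
  [Ring B] [StarRing B] [Algebra ℂ B] [StarModule ℂ B]
  [Ring Ω] [Algebra ℂ Ω] [StarAddMonoid Ω] [StarModule ℂ Ω]

/-- A differential calculus `Ω(P)` on the quantum principal bundle `P`: a graded-differential
`*`-algebra with `Ω⁰(P) = B`, generated by `B` as a differential algebra, such that `F` extends to a
homomorphism of graded-differential algebras from `Ω(P)` to the graded tensor product of `Ω(P)` and
the universal envelope `Γ^∧`. (The extension `Fhat` is determined by the other data.) -/
structure BundleCalculus (P : QuantumPrincipalBundle A V B) (C : BicovariantStarCalculus A Γ)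
    (𝒢 : ℕ → Submodule ℂ Ω) [GradedAlgebra 𝒢] extends GradedDifferentialStarAlgebra 𝒢 where
  /-- The identification of `B` with `Ω⁰(P)`. -/
  ofB : B ≃ₐ[ℂ] 𝒢 0
  ofB_star : ∀ b, (ofB (star b) : Ω) = star (ofB b : Ω)
  generated : ∀ S : Subalgebra ℂ Ω, (∀ b, (ofB b : Ω) ∈ S) → (∀ w ∈ S, d w ∈ S) → S = ⊤
  Fhat : Ω →ₐ[ℂ] GradedTensorProduct ℂ 𝒢 (Envelope.grade C.toFirstOrderCalculus)
  Fhat_ofB : ∀ b, (GradedTensorProduct.of ℂ 𝒢 (Envelope.grade C.toFirstOrderCalculus)).symm (Fhat (ofB b : Ω)) =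
    TensorProduct.map ((𝒢 0).subtype ∘ₗ ofB.toLinearMap)
      (Envelope.ofA C.toFirstOrderCalculus).toLinearMap (P.F b)
  Fhat_mem : ∀ k, ∀ w ∈ 𝒢 k, (GradedTensorProduct.of ℂ 𝒢 (Envelope.grade C.toFirstOrderCalculus)).symm (Fhat w) ∈
    ⨆ (p : ℕ × ℕ) (_ : p.1 + p.2 = k), LinearMap.range (TensorProduct.map (𝒢 p.1).subtype
      (Envelope.grade C.toFirstOrderCalculus p.2).subtype)
  Fhat_d : ∀ w, (GradedTensorProduct.of ℂ 𝒢 (Envelope.grade C.toFirstOrderCalculus)).symm (Fhat (d w)) =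
    tensorDifferential 𝒢 d (Envelope.d C.toFirstOrderCalculus)
      ((GradedTensorProduct.of ℂ 𝒢 (Envelope.grade C.toFirstOrderCalculus)).symm (Fhat w))

namespace BundleCalculus

variable {P : QuantumPrincipalBundle A V B} {C : BicovariantStarCalculus A Γ}
  {𝒢 : ℕ → Submodule ℂ Ω} [GradedAlgebra 𝒢] (D : BundleCalculus P C 𝒢)

/-- The extension of `F` to `Ω(P)`, as a linear map. -/
def FhatLin : Ω →ₗ[ℂ] Ω ⊗[ℂ] C.Env :=
  (GradedTensorProduct.of ℂ 𝒢 (Envelope.grade C.toFirstOrderCalculus)).symm.toLinearMap ∘ₗ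
    D.Fhat.toLinearMap

/-- The right action `F^∧ = (id ⊗ p₀) Fhat : Ω(P) → Ω(P) ⊗ A` of the quantum group on forms. -/
def rightAction : Ω →ₗ[ℂ] Ω ⊗[ℂ] A :=
  TensorProduct.map LinearMap.id (Envelope.p₀ C.toFirstOrderCalculus).toLinearMap ∘ₗ D.FhatLin

/-- The verticalizing homomorphism `π_v : Ω(P) → B ⊗ Γ^∧_inv`, with its values regarded as elements
of `B ⊗ Γ^∧`. On `Ωᵏ(P)` it is `(id ⊗ π_inv pₖ) Fhat`, where `pₖ` is the projection onto the
forms of degree `k`. Since `Fhat` preserves the degree, this picks out the part of `Fhat(w)` whose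
first factor has degree zero. -/
def vert : Ω →ₗ[ℂ] B ⊗[ℂ] C.Env :=
  TensorProduct.map (D.ofB.symm.toLinearMap ∘ₗ zeroPart 𝒢) C.invProj ∘ₗ D.FhatLin

/-- A connection on the bundle: a hermitian pseudotensorial one-form `ω : Γ_inv → Ω¹(P)` with
`π_v ω(ϑ) = 1 ⊗ ϑ`. -/
structure IsConnection [IsCompactMatrixQuantumGroup A] (ω : C.inv →ₗ[ℂ] Ω) : Prop where
  degree_one : ∀ ϑ, ω ϑ ∈ 𝒢 1
  pseudotensorial : ∀ ϑ, D.rightAction (ω ϑ) =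
    TensorProduct.map ω LinearMap.id (C.adjointCoaction ϑ)
  hermitian : ∀ ϑ, ω (star ϑ) = star (ω ϑ)
  vertical : ∀ ϑ : C.inv,
    D.vert (ω ϑ) = (1 : B) ⊗ₜ[ℂ] Envelope.ofΓ C.toFirstOrderCalculus (ϑ : Γ)

end BundleCalculus
end BundleCalculus
end QuantumBundle

end

/-! The extended coaction cuts a one-form b d(b') into two pieces. The piece in Ω¹(P) ⊗ A is the
image of the diagonal coaction of b ⊗ b', and it gives F^∧. The piece in B ⊗ Γ is F(b)(id ⊗ d)F(b'),
and after π_inv it gives π_v. Hence it suffices to find an equivariant linear map s : Γ_inv → B ⊗ B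
with `verForm` (s ϑ) = 1 ⊗ ϑ, to compose it with b ⊗ b' ↦ b d(b'), and then to make the result
hermitian.

Without equivariance, solvability is freeness of the action (`exists_verForm_eq`). A left-invariant
form is π(a) = κ(a₁) d(a₂) for some a. Since a₁ π(a₂) = d(a), the map `verForm` is the canonical map
q ⊗ b ↦ q F(b) followed by q ⊗ a ↦ F(q)(1 ⊗ π(a)). The canonical map reaches 1 ⊗ a, which is then
sent to 1 ⊗ π(a).

An equivariant choice exists because comodules over A are completely reducible
(`isSemisimpleModule_slice`). A comodule M is viewed as a module over the free algebra on the dual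
of A, the functional f acting by (id ⊗ f)ρ; submodules are the subspaces stable under these
operators, and the free algebra imposes no relations to check. On the space of a unitary
representation these operators are closed under adjoints, so orthogonal complements are stable.
Matrix elements of unitary representations span A, so M ⊗ A is a sum of images of such spaces and is
semisimple. The coaction embeds M into M ⊗ A. Since B ⊗ B is semisimple, the equivariant map ϑ ↦ 1 ⊗
ϑ lifts through `verForm` (`exists_equivariant_lift`).

Finally ω is replaced by ½(ω(ϑ) + ω(ϑ^*)^*). The conditions survive because the coactions and the
vertical part are compatible with the involutions (`adjointCoaction_star`, `exists_star_form`). -/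

noncomputable section

set_option linter.unusedSectionVars false

namespace QuantumBundle

/-! ### Modules over a family of operators -/

section OpModule

variable {F M N : Type*} [AddCommGroup M] [Module ℂ M] [AddCommGroup N] [Module ℂ N]

/-- The space `M`, regarded as a module over the free algebra on the index set of a family of
operators. -/
def OpModule (_act : F → Module.End ℂ M) : Type _ := M

namespace OpModule

variable (act : F → Module.End ℂ M) (act' : F → Module.End ℂ N)

instance : AddCommGroup (OpModule act) := inferInstanceAs (AddCommGroup M)

instance : Module ℂ (OpModule act) := inferInstanceAs (Module ℂ M)

instance : Module (FreeAlgebra ℂ F) (OpModule act) :=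
  Module.compHom M (FreeAlgebra.lift ℂ act).toRingHom

theorem smul_def (r : FreeAlgebra ℂ F) (m : OpModule act) :
    r • m = (FreeAlgebra.lift ℂ act r (m : M) : M) := rfl

theorem ι_smul (f : F) (m : OpModule act) : FreeAlgebra.ι ℂ f • m = (act f (m : M) : M) := by
  rw [smul_def, FreeAlgebra.lift_ι_apply]

instance : IsScalarTower ℂ (FreeAlgebra ℂ F) (OpModule act) where
  smul_assoc c r m := by
    rw [smul_def, smul_def, map_smul]
    rfl

theorem lift_apply_mem {K : Submodule ℂ M} (hK : ∀ f, ∀ x ∈ K, act f x ∈ K)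
    (r : FreeAlgebra ℂ F) {x : M} (hx : x ∈ K) : FreeAlgebra.lift ℂ act r x ∈ K := by
  induction r using FreeAlgebra.induction generalizing x with
  | grade0 c => simpa [Module.algebraMap_end_apply] using K.smul_mem c hx
  | grade1 f => simpa using hK f x hx
  | mul a b ha hb => rw [map_mul, Module.End.mul_apply]; exact ha (hb hx)
  | add a b ha hb => rw [map_add, LinearMap.add_apply]; exact K.add_mem (ha hx) (hb hx)

/-- Intertwining the generators is enough, since the free algebra is built from them by sums,
products and scalars. -/
theorem apply_lift_apply (g : M →ₗ[ℂ] N) (hg : ∀ f m, g (act f m) = act' f (g m))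
    (r : FreeAlgebra ℂ F) (m : M) :
    g (FreeAlgebra.lift ℂ act r m) = FreeAlgebra.lift ℂ act' r (g m) := by
  induction r using FreeAlgebra.induction generalizing m with
  | grade0 c => simp [Module.algebraMap_end_apply]
  | grade1 f => simpa using hg f m
  | mul a b ha hb => rw [map_mul, map_mul, Module.End.mul_apply, Module.End.mul_apply, ha, hb]
  | add a b ha hb => simp only [map_add, LinearMap.add_apply, ha, hb]

variable {act act'}

/-- A linear map that commutes with the operators is linear over the free algebra. -/
def hom (g : M →ₗ[ℂ] N) (hg : ∀ f m, g (act f m) = act' f (g m)) :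
    OpModule act →ₗ[FreeAlgebra ℂ F] OpModule act' where
  toFun := g
  map_add' := g.map_add
  map_smul' r m := apply_lift_apply act act' g hg r m

/-- A stable subspace as a submodule. -/
def ofStable (K : Submodule ℂ M) (hK : ∀ f, ∀ x ∈ K, act f x ∈ K) :
    Submodule (FreeAlgebra ℂ F) (OpModule act) where
  carrier := (K : Set M)
  add_mem' := K.add_mem
  zero_mem' := K.zero_mem
  smul_mem' r _ hx := lift_apply_mem act hK r hx

/-- The underlying subspace of a submodule. -/
def toSubspace (K : Submodule (FreeAlgebra ℂ F) (OpModule act)) : Submodule ℂ M where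
  carrier := (K : Set (OpModule act))
  add_mem' := K.add_mem
  zero_mem' := K.zero_mem
  smul_mem' c _ hx := (K.restrictScalars ℂ).smul_mem c hx

theorem toSubspace_stable (K : Submodule (FreeAlgebra ℂ F) (OpModule act)) (f : F) (x : M)
    (hx : x ∈ toSubspace K) : act f x ∈ toSubspace K := by
  have h := K.smul_mem (FreeAlgebra.ι ℂ f) (x := (show OpModule act from x)) hx
  rwa [ι_smul] at h

/-- If every stable subspace has a stable complement, then the module is semisimple. -/
theorem isSemisimpleModule_of_exists_isCompl
    (h : ∀ K : Submodule ℂ M, (∀ f, ∀ x ∈ K, act f x ∈ K) →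
      ∃ L : Submodule ℂ M, (∀ f, ∀ x ∈ L, act f x ∈ L) ∧ IsCompl K L) :
    IsSemisimpleModule (FreeAlgebra ℂ F) (OpModule act) := by
  refine { exists_isCompl := fun K => ?_ }
  obtain ⟨L, hL, hKL⟩ := h (toSubspace K) (toSubspace_stable K)
  let L' : Submodule (FreeAlgebra ℂ F) (OpModule act) := ofStable L hL
  refine ⟨L', Submodule.disjoint_def.mpr fun x h1 h2 =>
    Submodule.disjoint_def.mp hKL.disjoint x h1 h2, ?_⟩
  rw [codisjoint_iff, eq_top_iff]
  intro x _
  have hx : (x : M) ∈ toSubspace K ⊔ L := by rw [hKL.sup_eq_top]; trivial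
  obtain ⟨y, hy, z, hz, e⟩ := (Submodule.mem_sup (p := toSubspace K) (p' := L)).mp hx
  exact (Submodule.mem_sup (p := K) (p' := L')).mpr ⟨y, hy, z, hz, e⟩

/-- A family of operators on a finite-dimensional Hilbert space that is closed under adjoints acts
semisimply. -/
theorem isSemisimpleModule_of_adjoint {E : Type*} [NormedAddCommGroup E] [InnerProductSpace ℂ E]
    [FiniteDimensional ℂ E] (act : F → Module.End ℂ E)
    (h : ∀ f, ∃ f', ∀ x y : E, inner ℂ (act f x) y = inner ℂ x (act f' y)) :
    IsSemisimpleModule (FreeAlgebra ℂ F) (OpModule act) := by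
  refine isSemisimpleModule_of_exists_isCompl fun K hK =>
    ⟨Kᗮ, fun f x hx => ?_, Submodule.isCompl_orthogonal K⟩
  obtain ⟨f', hf⟩ := h f
  rw [Submodule.mem_orthogonal'] at hx ⊢
  intro u hu
  rw [hf]
  exact hx _ (hK f' u hu)

end OpModule
end OpModule

/-! ### Unitary representations -/

section UnitaryCorep

variable {A : Type*} [Ring A] [StarRing A] [HopfAlgebra ℂ A] [StarModule ℂ A]

/-- The matrix of a finite-dimensional unitary representation of the quantum group. -/
structure IsUnitaryCorep {ι : Type} [Fintype ι] [DecidableEq ι] (v : Matrix ι ι A) : Prop where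
  unitary : v ∈ unitary (Matrix ι ι A)
  comul : ∀ i j, Coalgebra.comul (R := ℂ) (v i j) = ∑ k, v i k ⊗ₜ[ℂ] v k j
  counit : ∀ i j, Coalgebra.counit (R := ℂ) (v i j) = if i = j then 1 else 0

variable (A) in
/-- The matrix elements of finite-dimensional unitary representations. -/
def matrixElements : Set A :=
  {a | ∃ (n : ℕ) (v : Matrix (Fin n) (Fin n) A), IsUnitaryCorep v ∧ ∃ i j, a = v i j}

namespace IsUnitaryCorep

variable {ι κ : Type} [Fintype ι] [DecidableEq ι] [Fintype κ] [DecidableEq κ]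
  {v : Matrix ι ι A} {w : Matrix κ κ A}

theorem sum_mul_star (hv : IsUnitaryCorep v) (i j : ι) :
    ∑ k, v i k * star (v j k) = if i = j then 1 else 0 := by
  have h0 : v * star v = 1 := (Unitary.mem_iff.mp hv.unitary).2
  have h := congrFun (congrFun h0 i) j
  simpa [Matrix.mul_apply, Matrix.star_apply, Matrix.one_apply] using h

theorem sum_star_mul (hv : IsUnitaryCorep v) (i j : ι) :
    ∑ k, star (v k i) * v k j = if i = j then 1 else 0 := by
  have h0 : star v * v = 1 := (Unitary.mem_iff.mp hv.unitary).1
  have h := congrFun (congrFun h0 i) j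
  simpa [Matrix.mul_apply, Matrix.star_apply, Matrix.one_apply] using h

theorem of_sums (h1 : ∀ i j, ∑ k, v i k * star (v j k) = if i = j then 1 else 0)
    (h2 : ∀ i j, ∑ k, star (v k i) * v k j = if i = j then 1 else 0)
    (h3 : ∀ i j, Coalgebra.comul (R := ℂ) (v i j) = ∑ k, v i k ⊗ₜ[ℂ] v k j)
    (h4 : ∀ i j, Coalgebra.counit (R := ℂ) (v i j) = if i = j then 1 else 0) :
    IsUnitaryCorep v where
  unitary := by
    rw [Unitary.mem_iff]
    constructor
    · ext i j; simpa [Matrix.mul_apply, Matrix.star_apply, Matrix.one_apply] using h2 i j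
    · ext i j; simpa [Matrix.mul_apply, Matrix.star_apply, Matrix.one_apply] using h1 i j
  comul := h3
  counit := h4

theorem reindex (hv : IsUnitaryCorep v) (e : ι ≃ κ) : IsUnitaryCorep (v.submatrix e.symm e.symm) :=
  of_sums
    (fun i j => by
      simpa using (Equiv.sum_comp e.symm (fun k => v (e.symm i) k * star (v (e.symm j) k))).trans
        (hv.sum_mul_star _ _))
    (fun i j => by
      simpa using (Equiv.sum_comp e.symm (fun k => star (v k (e.symm i)) * v k (e.symm j))).trans
        (hv.sum_star_mul _ _))
    (fun i j => by
      simpa using (hv.comul _ _).trans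
        (Equiv.sum_comp e.symm (fun k => v (e.symm i) k ⊗ₜ[ℂ] v k (e.symm j))).symm)
    (fun i j => by simpa using hv.counit (e.symm i) (e.symm j))

/-- The tensor product of two unitary representations. -/
theorem kron (hv : IsUnitaryCorep v) (hw : IsUnitaryCorep w) :
    IsUnitaryCorep (Matrix.of fun (p q : ι × κ) => v p.1 q.1 * w p.2 q.2) :=
  of_sums
    (fun p q => by
      -- The involution reverses products, so here the two factors from `w` are adjacent and must be
      -- summed first. In the other unitarity relation the inner pair comes from `v`, and the order
      -- of summation is exchanged.
      have h : ∀ i : ι, ∑ k : κ, v p.1 i * w p.2 k * star (v q.1 i * w q.2 k) =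
          v p.1 i * (if p.2 = q.2 then 1 else 0) * star (v q.1 i) := fun i => by
        rw [← hw.sum_mul_star, Finset.mul_sum, Finset.sum_mul]
        exact Finset.sum_congr rfl fun k _ => by rw [star_mul]; simp only [mul_assoc]
      simp only [Matrix.of_apply, Fintype.sum_prod_type, h, Prod.ext_iff, ite_and]
      by_cases h1 : p.2 = q.2 <;> simp [h1, hv.sum_mul_star])
    (fun p q => by
      have h : ∀ k : κ, ∑ i : ι, star (v i p.1 * w k p.2) * (v i q.1 * w k q.2) =
          star (w k p.2) * (if p.1 = q.1 then 1 else 0) * w k q.2 := fun k => by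
        rw [← hv.sum_star_mul, Finset.mul_sum, Finset.sum_mul]
        exact Finset.sum_congr rfl fun i _ => by rw [star_mul]; simp only [mul_assoc]
      simp only [Matrix.of_apply, Fintype.sum_prod_type_right, h, Prod.ext_iff, ite_and]
      by_cases h1 : p.1 = q.1 <;> simp [h1, hw.sum_star_mul])
    (fun p q => by
      simp only [Matrix.of_apply, Bialgebra.comul_mul, hv.comul, hw.comul, Finset.sum_mul_sum,
        Algebra.TensorProduct.tmul_mul_tmul, Fintype.sum_prod_type])
    (fun p q => by
      simp only [Matrix.of_apply, Bialgebra.counit_mul, hv.counit, hw.counit, Prod.ext_iff,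
        ite_and]
      split_ifs <;> simp)

theorem mem_matrixElements (hv : IsUnitaryCorep v) (i j : ι) : v i j ∈ matrixElements A :=
  ⟨_, _, hv.reindex (Fintype.equivFin ι), Fintype.equivFin ι i, Fintype.equivFin ι j, by simp⟩

theorem one : IsUnitaryCorep (1 : Matrix Unit Unit A) :=
  of_sums (by simp) (by simp) (by simp [Algebra.TensorProduct.one_def]) (by simp)

/-- The antipode axiom makes the matrix κ(v) a left inverse of v, while unitarity makes v^* a right
inverse; the two must agree. -/
theorem antipode_apply (hv : IsUnitaryCorep v) (i j : ι) :
    HopfAlgebra.antipode ℂ (v i j) = star (v j i) := by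
  have h : ∀ j, ∑ k, HopfAlgebra.antipode ℂ (v i k) * v k j = if i = j then 1 else 0 := by
    intro j
    have h := HopfAlgebra.mul_antipode_rTensor_comul_apply (R := ℂ) (v i j)
    rw [hv.comul, hv.counit] at h
    simpa [apply_ite (algebraMap ℂ A)] using h
  calc HopfAlgebra.antipode ℂ (v i j)
      = ∑ k, HopfAlgebra.antipode ℂ (v i k) * ∑ l, v k l * star (v j l) := by
        simp [hv.sum_mul_star]
    _ = ∑ l, (∑ k, HopfAlgebra.antipode ℂ (v i k) * v k l) * star (v j l) := by
        simp only [Finset.mul_sum, Finset.sum_mul, mul_assoc]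
        exact Finset.sum_comm
    _ = star (v j i) := by simp [h]

end IsUnitaryCorep

/-- The matrix elements of unitary representations span the algebra of polynomial functions. -/
theorem span_matrixElements [IsCompactMatrixQuantumGroup A] :
    Submodule.span ℂ (matrixElements A) = ⊤ := by
  obtain ⟨n, u, h1, h2, h3, h4⟩ := IsCompactMatrixQuantumGroup.exists_unitary (A := A)
  have hu : IsUnitaryCorep u := ⟨h1, h2, h3⟩
  -- Tensor products of representations make the matrix elements a submonoid, not merely a set. It
  -- contains the generators, and the algebra that they generate is the linear span of their monoid
  -- closure. No conjugate representations are needed.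
  let S : Submonoid A :=
    { carrier := matrixElements A
      one_mem' := by simpa using IsUnitaryCorep.one.mem_matrixElements (A := A) () ()
      mul_mem' := by
        rintro _ _ ⟨n, v, hv, i, j, rfl⟩ ⟨m, w, hw, k, l, rfl⟩
        exact (hv.kron hw).mem_matrixElements (i, k) (j, l) }
  have hS : Submonoid.closure {a | ∃ i j, a = u i j} ≤ S := by
    rw [Submonoid.closure_le]
    rintro _ ⟨i, j, rfl⟩
    exact hu.mem_matrixElements i j
  rw [eq_top_iff, ← Algebra.top_toSubmodule, ← h4, Algebra.adjoin_eq_span]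
  exact Submodule.span_mono hS

end UnitaryCorep

/-! ### Complete reducibility of comodules -/

section Comodule

variable {A : Type*} [Ring A] [StarRing A] [HopfAlgebra ℂ A] [StarModule ℂ A]
  {M X W : Type*} [AddCommGroup M] [Module ℂ M] [AddCommGroup X] [Module ℂ X]
  [AddCommGroup W] [Module ℂ W]

/-- The operator `(id ⊗ f) ρ`. -/
def slice (ρ : M →ₗ[ℂ] M ⊗[ℂ] A) (f : Module.Dual ℂ A) : Module.End ℂ M :=
  (TensorProduct.rid ℂ M).toLinearMap ∘ₗ f.lTensor M ∘ₗ ρ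

theorem slice_apply (ρ : M →ₗ[ℂ] M ⊗[ℂ] A) (f : Module.Dual ℂ A) (m : M) :
    slice ρ f m = TensorProduct.rid ℂ M (f.lTensor M (ρ m)) := rfl

variable (A M) in
/-- The coaction `id ⊗ φ` on `M ⊗ A`. -/
def cofree : M ⊗[ℂ] A →ₗ[ℂ] (M ⊗[ℂ] A) ⊗[ℂ] A :=
  (TensorProduct.assoc ℂ M A A).symm.toLinearMap ∘ₗ Coalgebra.comul.lTensor M

/-- Coordinate functionals of a basis of A already separate the points of M ⊗ A. This is what turns
commutation with all slices back into equivariance. -/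
theorem eq_of_lTensor_dual_eq {s t : M ⊗[ℂ] A}
    (h : ∀ f : Module.Dual ℂ A, TensorProduct.rid ℂ M (f.lTensor M s) =
      TensorProduct.rid ℂ M (f.lTensor M t)) : s = t := by
  classical
  let b := Module.Basis.ofVectorSpace ℂ A
  apply (TensorProduct.equivFinsuppOfBasisRight (M := M) b).injective
  ext i
  have hb : ∀ t : M ⊗[ℂ] A, TensorProduct.equivFinsuppOfBasisRight b t i =
      TensorProduct.rid ℂ M ((b.coord i).lTensor M t) := by
    intro t
    induction t with
    | zero => simp
    | tmul m a => simp
    | add x y hx hy => simp only [map_add, Finsupp.add_apply, hx, hy]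
  rw [hb, hb, h]

/-- The action of the functional `f` on the space of a unitary representation. -/
def matrixAct {n : ℕ} (v : Matrix (Fin n) (Fin n) A) (f : Module.Dual ℂ A) :
    Module.End ℂ (EuclideanSpace ℂ (Fin n)) :=
  Matrix.toEuclideanLin (v.map f)

theorem IsUnitaryCorep.isSemisimpleModule {n : ℕ} {v : Matrix (Fin n) (Fin n) A}
    (hv : IsUnitaryCorep v) :
    IsSemisimpleModule (FreeAlgebra ℂ (Module.Dual ℂ A)) (OpModule (matrixAct v)) := by
  refine OpModule.isSemisimpleModule_of_adjoint _ fun f => ?_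
  -- The functional a ↦ conj(f(κ(a)^*)): since κ(vᵢⱼ) = vⱼᵢ^*, its value at vᵢⱼ is the conjugate of
  -- f(vⱼᵢ), so f' acts by the adjoint of the operator of f.
  let f' : Module.Dual ℂ A :=
    { toFun := fun a => star (f (star (HopfAlgebra.antipode ℂ a)))
      map_add' := by simp
      map_smul' := by simp }
  have h : v.map f' = (v.map f).conjTranspose := by
    ext i j
    simp [f', hv.antipode_apply]
  refine ⟨f', fun x y => ?_⟩
  rw [matrixAct, matrixAct, h, Matrix.toEuclideanLin_conjTranspose_eq_adjoint,
    LinearMap.adjoint_inner_right]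

/-- The row `x ↦ m ⊗ ∑ⱼ xⱼ vᵢⱼ` of matrix elements. -/
def row {n : ℕ} (v : Matrix (Fin n) (Fin n) A) (m : M) (i : Fin n) :
    EuclideanSpace ℂ (Fin n) →ₗ[ℂ] M ⊗[ℂ] A where
  toFun x := ∑ j, x j • (m ⊗ₜ v i j)
  map_add' x y := by simp [add_smul, Finset.sum_add_distrib]
  map_smul' c x := by simp [mul_smul, Finset.smul_sum]

theorem row_apply {n : ℕ} (v : Matrix (Fin n) (Fin n) A) (m : M) (i : Fin n)
    (x : EuclideanSpace ℂ (Fin n)) : row v m i x = ∑ j, x j • (m ⊗ₜ v i j) := rfl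

/-- Each row of matrix elements carries a copy of the representation: φ(vᵢⱼ) = ∑ₖ vᵢₖ ⊗ vₖⱼ fixes
the row index i and transforms j exactly as the basis vector eⱼ. -/
theorem row_matrixAct {n : ℕ} {v : Matrix (Fin n) (Fin n) A} (hv : IsUnitaryCorep v) (m : M)
    (i : Fin n) (f : Module.Dual ℂ A) (x : EuclideanSpace ℂ (Fin n)) :
    row v m i (matrixAct v f x) = slice (cofree A M) f (row v m i x) := by
  have h : ∀ j, slice (cofree A M) f (m ⊗ₜ v i j) = ∑ k, f (v k j) • (m ⊗ₜ v i k) := by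
    intro j
    simp [slice_apply, cofree, hv.comul, TensorProduct.tmul_sum]
  simp only [row_apply, map_sum, map_smul, h, Finset.smul_sum]
  rw [Finset.sum_comm]
  refine Finset.sum_congr rfl fun k _ => ?_
  have : matrixAct v f x k = ∑ j, f (v k j) * x j := by
    simp [matrixAct, Matrix.mulVec, dotProduct]
  rw [this, Finset.sum_smul]
  exact Finset.sum_congr rfl fun j _ => by rw [mul_comm, mul_smul]

variable (A M) in
-- The rows m ⊗ vᵢⱼ, over all m, all unitary v and all i, are images of semisimple modules, and they
-- exhaust M ⊗ A because the matrix elements span A.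
theorem isSemisimpleModule_cofree [IsCompactMatrixQuantumGroup A] :
    IsSemisimpleModule (FreeAlgebra ℂ (Module.Dual ℂ A)) (OpModule (slice (cofree A M))) := by
  let I := {x : M × (Σ n : ℕ, Matrix (Fin n) (Fin n) A × Fin n) // IsUnitaryCorep x.2.2.1}
  let r : ∀ x : I, OpModule (matrixAct x.1.2.2.1) →ₗ[FreeAlgebra ℂ (Module.Dual ℂ A)]
      OpModule (slice (cofree A M)) :=
    fun x => OpModule.hom (row x.1.2.2.1 x.1.1 x.1.2.2.2) (row_matrixAct x.2 _ _)
  refine isSemisimpleModule_of_isSemisimpleModule_submodule' (p := fun x => LinearMap.range (r x))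
    (fun x => ?_) ?_
  · have := x.2.isSemisimpleModule
    exact IsSemisimpleModule.range (r x)
  · have key : ∀ t : M ⊗[ℂ] A, t ∈ OpModule.toSubspace (⨆ x, LinearMap.range (r x)) := by
      intro t
      induction t with
      | zero => exact Submodule.zero_mem _
      | add x y hx hy => exact Submodule.add_mem _ hx hy
      | tmul m a =>
        have ha : a ∈ Submodule.span ℂ (matrixElements A) := by
          rw [span_matrixElements]; trivial
        induction ha using Submodule.span_induction with
        | zero => rw [TensorProduct.tmul_zero]; exact Submodule.zero_mem _
        | add x y _ _ hx hy => rw [TensorProduct.tmul_add]; exact Submodule.add_mem _ hx hy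
        | smul c x _ hx => rw [TensorProduct.tmul_smul]; exact Submodule.smul_mem _ c hx
        | mem a ha =>
          obtain ⟨n, v, hv, i, j, rfl⟩ := ha
          let x : I := ⟨(m, ⟨n, v, i⟩), hv⟩
          have hx : LinearMap.range (r x) ≤ ⨆ x, LinearMap.range (r x) :=
            le_iSup (fun x => LinearMap.range (r x)) x
          -- The basis vector eⱼ is sent to m ⊗ vᵢⱼ.
          refine hx ⟨(EuclideanSpace.single j (1 : ℂ) : EuclideanSpace ℂ (Fin n)), ?_⟩
          refine (row_apply v m i _).trans ?_
          rw [Finset.sum_eq_single j] <;> simp +contextual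
    rw [eq_top_iff]
    exact fun t _ => key t

/-- Comodules are completely reducible. -/
theorem isSemisimpleModule_slice [IsCompactMatrixQuantumGroup A] (ρ : M →ₗ[ℂ] M ⊗[ℂ] A)
    (hcoassoc : ∀ m, Coalgebra.comul.lTensor M (ρ m) =
      TensorProduct.assoc ℂ M A A (ρ.rTensor A (ρ m)))
    (hcounit : ∀ m, TensorProduct.rid ℂ M (Coalgebra.counit.lTensor M (ρ m)) = m) :
    IsSemisimpleModule (FreeAlgebra ℂ (Module.Dual ℂ A)) (OpModule (slice ρ)) := by
  have := isSemisimpleModule_cofree A M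
  refine IsSemisimpleModule.of_injective
    (OpModule.hom (act' := slice (cofree A M)) ρ fun f m => ?_) ?_
  -- Coassociativity says precisely that ρ is equivariant from M to the cofree comodule M ⊗ A.
  · rw [slice_apply, slice_apply, cofree, LinearMap.comp_apply, hcoassoc]
    simp only [LinearEquiv.coe_coe, LinearEquiv.symm_apply_apply]
    generalize ρ m = t
    induction t with
    | zero => simp
    | tmul m a => simp
    | add x y hx hy => simp only [map_add, hx, hy]
  -- The counit axiom provides the left inverse id ⊗ ε of ρ.
  · exact Function.LeftInverse.injective
      (g := fun t : M ⊗[ℂ] A => TensorProduct.rid ℂ M (Coalgebra.counit.lTensor M t)) hcounit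

theorem map_slice {ρ : M →ₗ[ℂ] M ⊗[ℂ] A} {τ : X →ₗ[ℂ] X ⊗[ℂ] A} {p : M →ₗ[ℂ] X}
    (h : ∀ m, p.rTensor A (ρ m) = τ (p m)) (f : Module.Dual ℂ A) (m : M) :
    p (slice ρ f m) = slice τ f (p m) := by
  rw [slice_apply, slice_apply, ← h]
  generalize ρ m = t
  induction t with
  | zero => simp
  | tmul m a => simp
  | add x y hx hy => simp only [map_add, hx, hy]

/-- Equivariant maps lift along equivariant maps out of comodules. -/
theorem exists_equivariant_lift [IsCompactMatrixQuantumGroup A] (ρ : M →ₗ[ℂ] M ⊗[ℂ] A)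
    (hcoassoc : ∀ m, Coalgebra.comul.lTensor M (ρ m) =
      TensorProduct.assoc ℂ M A A (ρ.rTensor A (ρ m)))
    (hcounit : ∀ m, TensorProduct.rid ℂ M (Coalgebra.counit.lTensor M (ρ m)) = m)
    (τ : X →ₗ[ℂ] X ⊗[ℂ] A) (σ : W →ₗ[ℂ] W ⊗[ℂ] A) (p : M →ₗ[ℂ] X) (j : W →ₗ[ℂ] X)
    (hp : ∀ m, p.rTensor A (ρ m) = τ (p m)) (hj : ∀ w, j.rTensor A (σ w) = τ (j w))
    (hjp : ∀ w, ∃ m, p m = j w) :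
    ∃ s : W →ₗ[ℂ] M, (∀ w, p (s w) = j w) ∧ ∀ w, ρ (s w) = s.rTensor A (σ w) := by
  have := isSemisimpleModule_slice ρ hcoassoc hcounit
  let P : OpModule (slice ρ) →ₗ[FreeAlgebra ℂ (Module.Dual ℂ A)] OpModule (slice τ) :=
    OpModule.hom p (map_slice hp)
  let J : OpModule (slice σ) →ₗ[FreeAlgebra ℂ (Module.Dual ℂ A)] OpModule (slice τ) :=
    OpModule.hom j (map_slice hj)
  -- `p` need not be surjective, so the lifting is done through its corestriction to its range,
  -- which contains the range of `j` by `hjp`. Only the source of `p` has to be semisimple; `τ` and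
  -- `σ` enter through equivariance alone.
  obtain ⟨S, hS⟩ := IsSemisimpleModule.lifting_property P.rangeRestrict
    P.surjective_rangeRestrict (J.codRestrict (LinearMap.range P) fun w => hjp w)
  let s : W →ₗ[ℂ] M := S.restrictScalars ℂ
  have hs : ∀ f w, s (slice σ f w) = slice ρ f (s w) := fun f w => by
    have h := S.map_smul (FreeAlgebra.ι ℂ f) w
    rw [OpModule.ι_smul] at h
    exact (congrArg S (OpModule.ι_smul _ f w)).symm.trans h
  refine ⟨s, fun w => congrArg Subtype.val (LinearMap.congr_fun hS w), fun w => ?_⟩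
  refine eq_of_lTensor_dual_eq fun f => ?_
  refine (hs f w).symm.trans ?_
  rw [slice_apply]
  generalize σ w = t
  induction t with
  | zero => simp
  | tmul m a => simp
  | add x y hx hy => simp only [map_add, hx, hy]

end Comodule

/-! ### Left-invariant forms -/

namespace BicovariantStarCalculus

variable {A Γ : Type*} [Ring A] [HopfAlgebra ℂ A]
  [AddCommGroup Γ] [Module ℂ Γ] [Module A Γ] [Module Aᵐᵒᵖ Γ] [SMulCommClass A Aᵐᵒᵖ Γ]
  [IsScalarTower ℂ A Γ] [IsScalarTower ℂ Aᵐᵒᵖ Γ]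
  [StarRing A] [StarModule ℂ A] [StarAddMonoid Γ] [StarModule ℂ Γ]
  (C : BicovariantStarCalculus A Γ)

/-- The left multiplication `A ⊗ Γ → Γ`. -/
def leftMul : A ⊗[ℂ] Γ →ₗ[ℂ] Γ := TensorProduct.lift (Algebra.lsmul ℂ ℂ Γ).toLinearMap

@[simp] theorem leftMul_tmul (a : A) (γ : Γ) : leftMul (a ⊗ₜ[ℂ] γ) = a • γ := rfl

/-- The map `π(a) = κ(a₍₁₎) d(a₍₂₎)`. -/
def germ : A →ₗ[ℂ] Γ :=
  C.toForm ∘ₗ (HopfAlgebra.antipode ℂ).rTensor A ∘ₗ Coalgebra.comul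

theorem germ_apply (a : A) :
    C.germ a = C.toForm ((HopfAlgebra.antipode ℂ).rTensor A (Coalgebra.comul a)) := rfl

/-- The form d is recovered from π by a₁ π(a₂) = a₁ κ(a₂) d(a₃) = ε(a₁) d(a₂) = d(a), using
coassociativity, the antipode axiom and the counit axiom. -/
theorem leftMul_germ (a : A) : leftMul (C.germ.lTensor A (Coalgebra.comul a)) = C.d a := by
  have h1 : ∀ z : A ⊗[ℂ] A, leftMul (C.germ.lTensor A z) =
      leftMul ((C.toForm ∘ₗ (HopfAlgebra.antipode ℂ).rTensor A).lTensor A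
        (Coalgebra.comul.lTensor A z)) := by
    intro z
    rw [← LinearMap.comp_apply (LinearMap.lTensor A _), ← LinearMap.lTensor_comp]
    rfl
  have h2 : ∀ (w : A ⊗[ℂ] A) (y : A),
      leftMul ((C.toForm ∘ₗ (HopfAlgebra.antipode ℂ).rTensor A).lTensor A
        (TensorProduct.assoc ℂ A A A (w ⊗ₜ y))) =
      LinearMap.mul' ℂ A ((HopfAlgebra.antipode ℂ).lTensor A w) • C.d y := by
    intro w y
    induction w with
    | zero => simp
    | tmul p q => simp [mul_smul]
    | add p q hp hq => simp only [TensorProduct.add_tmul, map_add, hp, hq, add_smul]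
  have h3 : ∀ z : A ⊗[ℂ] A, leftMul ((C.toForm ∘ₗ (HopfAlgebra.antipode ℂ).rTensor A).lTensor A
        (TensorProduct.assoc ℂ A A A (Coalgebra.comul.rTensor A z))) =
      C.d (TensorProduct.lid ℂ A (Coalgebra.counit.rTensor A z)) := by
    intro z
    induction z with
    | zero => simp
    | tmul p q =>
      rw [LinearMap.rTensor_tmul, h2, HopfAlgebra.mul_antipode_lTensor_comul_apply]
      simp
    | add p q hp hq => simp only [map_add, hp, hq]
  rw [h1, ← Coalgebra.coassoc_apply, h3, Coalgebra.rTensor_counit_comul]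
  simp

/-- With y = φ(b), this is κ(a₁b₁) a₂ d(b₂) = κ(b₁) κ(a₁)a₂ d(b₂) = ε(a) π(b): the antipode reverses
products, which brings κ(a₁) next to a₂. A general y is allowed so that it can be decomposed. -/
theorem leftMul_antipode_leftPair (a : A) (y : A ⊗[ℂ] A) :
    leftMul ((HopfAlgebra.antipode ℂ).rTensor Γ (C.leftPair (Coalgebra.comul a) y)) =
      Coalgebra.counit (R := ℂ) a • C.toForm ((HopfAlgebra.antipode ℂ).rTensor A y) := by
  induction y with
  | zero => simp
  | add p q hp hq => simp only [map_add, smul_add, hp, hq]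
  | tmul r s =>
    have h : ∀ x : A ⊗[ℂ] A,
        leftMul ((HopfAlgebra.antipode ℂ).rTensor Γ (C.leftPair x (r ⊗ₜ s))) =
        HopfAlgebra.antipode ℂ r • LinearMap.mul' ℂ A ((HopfAlgebra.antipode ℂ).rTensor A x) •
          C.d s := by
      intro x
      induction x with
      | zero => simp
      | add p q hp hq => simp only [map_add, LinearMap.add_apply, add_smul, smul_add, hp, hq]
      | tmul p q => simp [HopfAlgebra.antipode_mul_antidistrib, mul_smul]
    rw [h, HopfAlgebra.mul_antipode_rTensor_comul_apply, algebraMap_smul, LinearMap.rTensor_tmul,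
      C.toForm_tmul, smul_comm]

/-- The projection γ ↦ κ(γ₍₋₁₎) γ₍₀₎ sends a d(b) to ε(a) π(b), so its values lie in the image of π;
it fixes left-invariant forms, because ℓ(ϑ) = 1 ⊗ ϑ and κ(1) = 1. -/
theorem exists_germ_eq {ϑ : Γ} (h : ϑ ∈ C.inv) : ∃ a, C.germ a = ϑ := by
  have key : ∀ γ : Γ, ∃ a, C.germ a =
      leftMul ((HopfAlgebra.antipode ℂ).rTensor Γ (C.leftCoaction γ)) := by
    intro γ
    induction γ using C.induction with
    | h a b =>
      refine ⟨Coalgebra.counit (R := ℂ) a • b, ?_⟩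
      rw [leftCoaction_smul_d, leftMul_antipode_leftPair, map_smul, germ_apply]
    | hadd x y hx hy =>
      obtain ⟨a, ha⟩ := hx
      obtain ⟨b, hb⟩ := hy
      exact ⟨a + b, by simp only [map_add, ha, hb]⟩
  obtain ⟨a, ha⟩ := key ϑ
  refine ⟨a, ha.trans ?_⟩
  rw [C.mem_inv.mp h]
  simp

theorem invProj_ofΓ {ϑ : Γ} (h : ϑ ∈ C.inv) :
    C.invProj (Envelope.ofΓ C.toFirstOrderCalculus ϑ) = Envelope.ofΓ C.toFirstOrderCalculus ϑ := by
  have h1 : C.envLeftCoaction (Envelope.ofΓ C.toFirstOrderCalculus ϑ) =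
      1 ⊗ₜ Envelope.ofΓ C.toFirstOrderCalculus ϑ := by
    rw [envLeftCoaction, Envelope.lift_ofΓ, envLeftΓ, LinearMap.comp_apply, C.mem_inv.mp h]
    simp
  simp [invProj, h1]

/-- The Leibniz rule puts (a d(b))^* = d(b^*) a^* back in the form d(b^* a^*) - b^* d(a^*), with
coefficients on the left. The same identity underlies `star_verPair` and `star_form_tmul`. -/
theorem star_rightPair (x y : A ⊗[ℂ] A) : star (C.rightPair x y) =
    C.rightPair 1 (star y * star x) - C.rightPair (star y) (star x) := by
  induction x with
  | zero => simp
  | add x x' hx hx' => simp only [map_add, LinearMap.add_apply, star_add, hx, hx', mul_add]; abel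
  | tmul a b =>
    induction y with
    | zero => simp
    | add x x' hx hx' => simp only [map_add, LinearMap.add_apply, star_add, hx, hx', add_mul]; abel
    | tmul c e =>
      simp [C.star_smul_d, C.leibniz, TensorProduct.add_tmul, Algebra.TensorProduct.one_def]

variable [IsCompactMatrixQuantumGroup A]

theorem rightCoaction_star (γ : Γ) : C.rightCoaction (star γ) = star (C.rightCoaction γ) := by
  induction γ using C.induction with
  | hadd x y hx hy => simp only [star_add, map_add, hx, hy]
  | h a b =>
    have h1 := C.op_smul_smul_d 1 (star b) (star a)
    rw [one_smul, one_mul] at h1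
    rw [C.star_smul_d, h1, map_sub, rightCoaction_smul_d, rightCoaction_smul_d,
      rightCoaction_smul_d, star_rightPair, Bialgebra.comul_mul, Bialgebra.comul_one,
      IsCompactMatrixQuantumGroup.comul_star, IsCompactMatrixQuantumGroup.comul_star]

instance : StarAddMonoid C.inv where
  star_involutive ϑ := Subtype.ext (star_star (ϑ : Γ))
  star_add x y := Subtype.ext (star_add (x : Γ) y)

instance : StarModule ℂ C.inv where
  star_smul c x := Subtype.ext (star_smul c (x : Γ))

theorem coe_star_inv (ϑ : C.inv) : ((star ϑ : C.inv) : Γ) = star (ϑ : Γ) := rfl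

/-- This keeps the hermitian part of a pseudotensorial form pseudotensorial. It is inherited from ℘,
since Γ_inv ⊗ A embeds in Γ ⊗ A. -/
theorem adjointCoaction_star (ϑ : C.inv) :
    C.adjointCoaction (star ϑ) = star (C.adjointCoaction ϑ) := by
  have h : ∀ z : C.inv ⊗[ℂ] A,
      C.inv.subtype.rTensor A (star z) = star (C.inv.subtype.rTensor A z) := by
    intro z
    induction z with
    | zero => simp
    | tmul m a => simp [coe_star_inv]
    | add x y hx hy => simp only [star_add, map_add, hx, hy]
  apply C.rTensor_subtype_injective
  rw [h, adjointCoaction_spec, adjointCoaction_spec, coe_star_inv, rightCoaction_star]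

end BicovariantStarCalculus

/-! ### The tensor square of the bundle -/

namespace QuantumPrincipalBundle

variable {A Γ V B : Type*} [Ring A] [StarRing A] [HopfAlgebra ℂ A] [StarModule ℂ A]
  [AddCommGroup Γ] [Module ℂ Γ] [Module A Γ] [Module Aᵐᵒᵖ Γ] [SMulCommClass A Aᵐᵒᵖ Γ]
  [IsScalarTower ℂ A Γ] [IsScalarTower ℂ Aᵐᵒᵖ Γ] [StarAddMonoid Γ] [StarModule ℂ Γ]
  [Ring V] [StarRing V] [Algebra ℂ V] [StarModule ℂ V]
  [Ring B] [StarRing B] [Algebra ℂ B] [StarModule ℂ B]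
  (P : QuantumPrincipalBundle A V B) (C : BicovariantStarCalculus A Γ)

/-- The coaction `F` as a linear map. -/
def FLin : B →ₗ[ℂ] B ⊗[ℂ] A := P.F.toAlgHom.toLinearMap

theorem FLin_apply (b : B) : P.FLin b = P.F b := rfl

variable (A B) in
/-- The map `(b ⊗ a, b' ⊗ a') ↦ b ⊗ b' ⊗ a a'`. -/
def diagPair : B ⊗[ℂ] A →ₗ[ℂ] B ⊗[ℂ] A →ₗ[ℂ] (B ⊗[ℂ] B) ⊗[ℂ] A :=
  TensorProduct.map₂ (TensorProduct.mk ℂ B B) (LinearMap.mul ℂ A)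

@[simp] theorem diagPair_tmul (b b' : B) (a a' : A) :
    diagPair A B (b ⊗ₜ a) (b' ⊗ₜ a') = (b ⊗ₜ b') ⊗ₜ (a * a') := rfl

/-- The diagonal coaction on `B ⊗ B`. -/
def diagCoaction : B ⊗[ℂ] B →ₗ[ℂ] (B ⊗[ℂ] B) ⊗[ℂ] A :=
  TensorProduct.lift ((diagPair A B).compl₁₂ P.FLin P.FLin)

@[simp] theorem diagCoaction_tmul (b b' : B) :
    P.diagCoaction (b ⊗ₜ b') = diagPair A B (P.F b) (P.F b') := rfl

variable (A B) in
/-- The map `(b ⊗ a, b' ⊗ a') ↦ b ⊗ b' ⊗ a a'` with `a` and `a'` in `A ⊗ A`. -/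
def diagPair₂ : B ⊗[ℂ] (A ⊗[ℂ] A) →ₗ[ℂ] B ⊗[ℂ] (A ⊗[ℂ] A) →ₗ[ℂ] (B ⊗[ℂ] B) ⊗[ℂ] (A ⊗[ℂ] A) :=
  TensorProduct.map₂ (TensorProduct.mk ℂ B B) (LinearMap.mul ℂ (A ⊗[ℂ] A))

@[simp] theorem diagPair₂_tmul (b b' : B) (a a' : A ⊗[ℂ] A) :
    diagPair₂ A B (b ⊗ₜ a) (b' ⊗ₜ a') = (b ⊗ₜ b') ⊗ₜ (a * a') := rfl

theorem comul_diagPair (x y : B ⊗[ℂ] A) :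
    Coalgebra.comul.lTensor (B ⊗[ℂ] B) (diagPair A B x y) =
      diagPair₂ A B (Coalgebra.comul.lTensor B x) (Coalgebra.comul.lTensor B y) := by
  induction x with
  | zero => simp
  | add x x' hx hx' => simp only [map_add, LinearMap.add_apply, hx, hx']
  | tmul b a =>
    induction y with
    | zero => simp
    | add x x' hx hx' => simp only [map_add, hx, hx']
    | tmul c e => simp

theorem assoc_diagCoaction_diagPair (x y : B ⊗[ℂ] A) :
    TensorProduct.assoc ℂ (B ⊗[ℂ] B) A A (P.diagCoaction.rTensor A (diagPair A B x y)) =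
      diagPair₂ A B (TensorProduct.assoc ℂ B A A (P.FLin.rTensor A x))
        (TensorProduct.assoc ℂ B A A (P.FLin.rTensor A y)) := by
  induction x with
  | zero => simp
  | add x x' hx hx' => simp only [map_add, LinearMap.add_apply, hx, hx']
  | tmul b a =>
    induction y with
    | zero => simp
    | add x x' hx hx' => simp only [map_add, hx, hx']
    | tmul c e =>
      simp only [diagPair_tmul, LinearMap.rTensor_tmul, diagCoaction_tmul, FLin_apply]
      generalize P.F b = u
      generalize P.F c = v
      induction u with
      | zero => simp
      | add x x' hx hx' =>
        simp only [map_add, LinearMap.add_apply, TensorProduct.add_tmul, hx, hx']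
      | tmul p q =>
        induction v with
        | zero => simp
        | add x x' hx hx' => simp only [map_add, TensorProduct.add_tmul, hx, hx']
        | tmul r s => simp

theorem lTensor_comul_F (b : B) : Coalgebra.comul.lTensor B (P.F b) =
    TensorProduct.assoc ℂ B A A (P.FLin.rTensor A (P.F b)) := P.coassoc b

/-- Both sides are the pairing `diagPair₂` of twofold coactions, one written with id ⊗ φ and the
other with F ⊗ id; coassociativity of F identifies them factor by factor. -/
theorem diagCoaction_coassoc (t : B ⊗[ℂ] B) :
    Coalgebra.comul.lTensor (B ⊗[ℂ] B) (P.diagCoaction t) =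
      TensorProduct.assoc ℂ (B ⊗[ℂ] B) A A (P.diagCoaction.rTensor A (P.diagCoaction t)) := by
  induction t with
  | zero => simp
  | add x y hx hy => simp only [map_add, hx, hy]
  | tmul b b' =>
    rw [diagCoaction_tmul, comul_diagPair, assoc_diagCoaction_diagPair, lTensor_comul_F,
      lTensor_comul_F]

theorem counit_diagPair (x y : B ⊗[ℂ] A) :
    TensorProduct.rid ℂ (B ⊗[ℂ] B) (Coalgebra.counit.lTensor (B ⊗[ℂ] B) (diagPair A B x y)) =
      TensorProduct.rid ℂ B (Coalgebra.counit.lTensor B x) ⊗ₜ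
        TensorProduct.rid ℂ B (Coalgebra.counit.lTensor B y) := by
  induction x with
  | zero => simp
  | add x x' hx hx' =>
    simp only [map_add, LinearMap.add_apply, TensorProduct.add_tmul, hx, hx']
  | tmul b a =>
    induction y with
    | zero => simp
    | add x x' hx hx' => simp only [map_add, TensorProduct.tmul_add, hx, hx']
    | tmul c e => simp [TensorProduct.smul_tmul', mul_smul, smul_comm (Coalgebra.counit (R := ℂ) a)]

theorem diagCoaction_counit (t : B ⊗[ℂ] B) :
    TensorProduct.rid ℂ (B ⊗[ℂ] B) (Coalgebra.counit.lTensor (B ⊗[ℂ] B) (P.diagCoaction t)) =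
      t := by
  induction t with
  | zero => simp
  | add x y hx hy => simp only [map_add, hx, hy]
  | tmul b b' => rw [diagCoaction_tmul, counit_diagPair, P.counit, P.counit]

/-! ### Vertical parts of one-forms -/

variable (B) in
/-- The map `(b ⊗ a, b' ⊗ a') ↦ b b' ⊗ a d(a')`. -/
def verPair : B ⊗[ℂ] A →ₗ[ℂ] B ⊗[ℂ] A →ₗ[ℂ] B ⊗[ℂ] Γ :=
  TensorProduct.map₂ (LinearMap.mul ℂ B) ((Algebra.lsmul ℂ ℂ Γ).toLinearMap.compl₂ C.d)

@[simp] theorem verPair_tmul (b b' : B) (a a' : A) :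
    verPair B C (b ⊗ₜ a) (b' ⊗ₜ a') = (b * b') ⊗ₜ (a • C.d a') := rfl

/-- The vertical part `F(b) (id ⊗ d)F(b')` of the form `b d(b')`. -/
def verForm : B ⊗[ℂ] B →ₗ[ℂ] B ⊗[ℂ] Γ :=
  TensorProduct.lift ((verPair B C).compl₁₂ P.FLin P.FLin)

@[simp] theorem verForm_tmul (b b' : B) :
    P.verForm C (b ⊗ₜ b') = verPair B C (P.F b) (P.F b') := rfl

variable (B) in
/-- The map `(b ⊗ x, b' ⊗ x') ↦ b b' ⊗ x (d ⊗ id)(x')`. -/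
def verPair₂ : B ⊗[ℂ] (A ⊗[ℂ] A) →ₗ[ℂ] B ⊗[ℂ] (A ⊗[ℂ] A) →ₗ[ℂ] B ⊗[ℂ] (Γ ⊗[ℂ] A) :=
  TensorProduct.map₂ (LinearMap.mul ℂ B) C.rightPair

@[simp] theorem verPair₂_tmul (b b' : B) (a a' : A ⊗[ℂ] A) :
    verPair₂ B C (b ⊗ₜ a) (b' ⊗ₜ a') = (b * b') ⊗ₜ C.rightPair a a' := rfl

theorem rightCoaction_verPair (x y : B ⊗[ℂ] A) :
    C.rightCoaction.lTensor B (verPair B C x y) =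
      verPair₂ B C (Coalgebra.comul.lTensor B x) (Coalgebra.comul.lTensor B y) := by
  induction x with
  | zero => simp
  | add x x' hx hx' => simp only [map_add, LinearMap.add_apply, hx, hx']
  | tmul b a =>
    induction y with
    | zero => simp
    | add x x' hx hx' => simp only [map_add, hx, hx']
    | tmul c e => simp [C.rightCoaction_smul_d]

theorem assoc_verForm_diagPair (x y : B ⊗[ℂ] A) :
    TensorProduct.assoc ℂ B Γ A ((P.verForm C).rTensor A (diagPair A B x y)) =
      verPair₂ B C (TensorProduct.assoc ℂ B A A (P.FLin.rTensor A x))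
        (TensorProduct.assoc ℂ B A A (P.FLin.rTensor A y)) := by
  induction x with
  | zero => simp
  | add x x' hx hx' => simp only [map_add, LinearMap.add_apply, hx, hx']
  | tmul b a =>
    induction y with
    | zero => simp
    | add x x' hx hx' => simp only [map_add, hx, hx']
    | tmul c e =>
      simp only [diagPair_tmul, LinearMap.rTensor_tmul, verForm_tmul, FLin_apply]
      generalize P.F b = u
      generalize P.F c = v
      induction u with
      | zero => simp
      | add x x' hx hx' =>
        simp only [map_add, LinearMap.add_apply, TensorProduct.add_tmul, hx, hx']
      | tmul p q =>
        induction v with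
        | zero => simp
        | add x x' hx hx' => simp only [map_add, TensorProduct.add_tmul, hx, hx']
        | tmul r s => simp

variable (B) in
/-- The coaction `id ⊗ ℘` on `B ⊗ Γ`. -/
def formCoaction : B ⊗[ℂ] Γ →ₗ[ℂ] (B ⊗[ℂ] Γ) ⊗[ℂ] A :=
  (TensorProduct.assoc ℂ B Γ A).symm.toLinearMap ∘ₗ C.rightCoaction.lTensor B

/-- The target carries the coaction id ⊗ ℘, trivial on B: by coassociativity of F, the last legs in
b₀b'₀ ⊗ b₁ d(b'₁) ⊗ b₂b'₂ come from comultiplying b₁ and b'₁, which is what ℘ does to b₁ d(b'₁). -/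
theorem verForm_diagCoaction (t : B ⊗[ℂ] B) :
    (P.verForm C).rTensor A (P.diagCoaction t) = formCoaction B C (P.verForm C t) := by
  rw [formCoaction, LinearMap.comp_apply, LinearEquiv.coe_coe, LinearEquiv.eq_symm_apply]
  induction t with
  | zero => simp
  | add x y hx hy => simp only [map_add, hx, hy]
  | tmul b b' =>
    rw [diagCoaction_tmul, verForm_tmul, assoc_verForm_diagPair, rightCoaction_verPair,
      lTensor_comul_F, lTensor_comul_F]

variable (B) in
/-- The map `ϑ ↦ 1 ⊗ ϑ`. -/
def oneTensor : C.inv →ₗ[ℂ] B ⊗[ℂ] Γ := TensorProduct.mk ℂ B Γ 1 ∘ₗ C.inv.subtype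

@[simp] theorem oneTensor_apply (ϑ : C.inv) : oneTensor B C ϑ = 1 ⊗ₜ (ϑ : Γ) := rfl

theorem oneTensor_adjointCoaction (ϑ : C.inv) :
    (oneTensor B C).rTensor A (C.adjointCoaction ϑ) = formCoaction B C (oneTensor B C ϑ) := by
  rw [formCoaction, LinearMap.comp_apply, LinearEquiv.coe_coe, LinearEquiv.eq_symm_apply,
    oneTensor_apply, LinearMap.lTensor_tmul, ← C.adjointCoaction_spec]
  generalize C.adjointCoaction ϑ = z
  induction z with
  | zero => simp
  | tmul m a => simp
  | add x y hx hy => simp only [map_add, TensorProduct.tmul_add, hx, hy]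

/-! ### Surjectivity of the vertical part -/

variable (A Γ B) in
/-- The left action of `B ⊗ A` on `B ⊗ Γ`. -/
def tensorAct : B ⊗[ℂ] A →ₗ[ℂ] B ⊗[ℂ] Γ →ₗ[ℂ] B ⊗[ℂ] Γ :=
  TensorProduct.map₂ (LinearMap.mul ℂ B) (Algebra.lsmul ℂ ℂ Γ).toLinearMap

@[simp] theorem tensorAct_tmul (b b' : B) (a : A) (γ : Γ) :
    tensorAct A Γ B (b ⊗ₜ a) (b' ⊗ₜ γ) = (b * b') ⊗ₜ (a • γ) := rfl

theorem tensorAct_mul (x y : B ⊗[ℂ] A) (z : B ⊗[ℂ] Γ) :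
    tensorAct A Γ B (x * y) z = tensorAct A Γ B x (tensorAct A Γ B y z) := by
  induction z with
  | zero => simp
  | add z z' hz hz' => simp only [map_add, hz, hz']
  | tmul c γ =>
    induction x with
    | zero => simp
    | add x x' hx hx' => simp only [add_mul, map_add, LinearMap.add_apply, hx, hx']
    | tmul b a =>
      induction y with
      | zero => simp
      | add x x' hx hx' => simp only [mul_add, map_add, LinearMap.add_apply, hx, hx']
      | tmul b' a' => simp [mul_assoc, mul_smul]

/-- The map `q ⊗ a ↦ F(q) (1 ⊗ π(a))`. -/
def ofGerm : B ⊗[ℂ] A →ₗ[ℂ] B ⊗[ℂ] Γ :=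
  TensorProduct.lift ((tensorAct A Γ B).compl₁₂ P.FLin (TensorProduct.mk ℂ B Γ 1 ∘ₗ C.germ))

@[simp] theorem ofGerm_tmul (q : B) (a : A) :
    P.ofGerm C (q ⊗ₜ a) = tensorAct A Γ B (P.F q) (1 ⊗ₜ C.germ a) := rfl

theorem ofGerm_tmul_one_mul (q : B) (y : B ⊗[ℂ] A) :
    P.ofGerm C ((q ⊗ₜ 1) * y) = tensorAct A Γ B (P.F q)
      ((BicovariantStarCalculus.leftMul ∘ₗ C.germ.lTensor A).lTensor B
        (TensorProduct.assoc ℂ B A A (P.FLin.rTensor A y))) := by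
  induction y with
  | zero => simp
  | add x x' hx hx' => simp only [mul_add, map_add, hx, hx']
  | tmul b a =>
    rw [Algebra.TensorProduct.tmul_mul_tmul, one_mul, ofGerm_tmul, map_mul, tensorAct_mul,
      LinearMap.rTensor_tmul, FLin_apply]
    congr 1
    generalize P.F b = u
    induction u with
    | zero => simp
    | add x x' hx hx' =>
      simp only [map_add, LinearMap.add_apply, TensorProduct.add_tmul, hx, hx']
    | tmul p q => simp

theorem tensorAct_lTensor_d (x y : B ⊗[ℂ] A) :
    tensorAct A Γ B x (C.d.lTensor B y) = verPair B C x y := by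
  induction x with
  | zero => simp
  | add x x' hx hx' => simp only [map_add, LinearMap.add_apply, hx, hx']
  | tmul b a =>
    induction y with
    | zero => simp
    | add x x' hx hx' => simp only [map_add, hx, hx']
    | tmul c e => simp

/-- The vertical part factors through the canonical map q ⊗ b ↦ q F(b): F(b₀)(1 ⊗ π(b₁)) = b₀ ⊗ b₁
π(b₂) = b₀ ⊗ d(b₁). -/
theorem ofGerm_tmul_one_mul_F (q b : B) :
    P.ofGerm C ((q ⊗ₜ 1) * P.F b) = P.verForm C (q ⊗ₜ b) := by
  rw [ofGerm_tmul_one_mul, ← lTensor_comul_F, ← LinearMap.comp_apply (LinearMap.lTensor B _),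
    ← LinearMap.lTensor_comp, verForm_tmul, ← tensorAct_lTensor_d]
  congr 3
  ext a
  exact C.leftMul_germ a

theorem exists_verForm_eq (ϑ : C.inv) : ∃ t, P.verForm C t = oneTensor B C ϑ := by
  obtain ⟨a, ha⟩ := C.exists_germ_eq ϑ.2
  -- Freeness of the action enters here, and only for elements 1 ⊗ a with π(a) = ϑ.
  obtain ⟨t, ht⟩ := P.free (1 ⊗ₜ a)
  refine ⟨t, ?_⟩
  have h : ∀ t : B ⊗[ℂ] B, P.verForm C t = P.ofGerm C (TensorProduct.lift
      ((LinearMap.mul ℂ (B ⊗[ℂ] A)).compl₁₂ ((TensorProduct.mk ℂ B A).flip 1)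
        P.F.toAlgHom.toLinearMap) t) := by
    intro t
    induction t with
    | zero => simp
    | add x y hx hy => simp only [map_add, hx, hy]
    | tmul q b => exact (P.ofGerm_tmul_one_mul_F C q b).symm
  rw [h, ht, ofGerm_tmul, map_one, Algebra.TensorProduct.one_def, tensorAct_tmul, one_mul, one_smul,
    ha, oneTensor_apply]

/-- The equivariant lifting of the vertical forms to `B ⊗ B`. -/
theorem exists_equivariant_section [IsCompactMatrixQuantumGroup A] :
    ∃ s : C.inv →ₗ[ℂ] B ⊗[ℂ] B, (∀ ϑ, P.verForm C (s ϑ) = oneTensor B C ϑ) ∧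
      ∀ ϑ, P.diagCoaction (s ϑ) = s.rTensor A (C.adjointCoaction ϑ) :=
  exists_equivariant_lift P.diagCoaction P.diagCoaction_coassoc P.diagCoaction_counit
    (formCoaction B C) C.adjointCoaction (P.verForm C) (oneTensor B C) (P.verForm_diagCoaction C)
    (oneTensor_adjointCoaction C) (P.exists_verForm_eq C)

theorem star_verPair (x y : B ⊗[ℂ] A) : star (verPair B C x y) =
    verPair B C 1 (star y * star x) - verPair B C (star y) (star x) := by
  induction x with
  | zero => simp
  | add x x' hx hx' => simp only [map_add, LinearMap.add_apply, star_add, hx, hx', mul_add]; abel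
  | tmul a b =>
    induction y with
    | zero => simp
    | add x x' hx hx' => simp only [map_add, LinearMap.add_apply, star_add, hx, hx', add_mul]; abel
    | tmul c e =>
      simp [C.star_smul_d, C.leibniz, TensorProduct.tmul_add, Algebra.TensorProduct.one_def]

end QuantumPrincipalBundle

/-! ### Existence of connections -/

namespace BundleCalculus

open QuantumPrincipalBundle

variable {A Γ V B Ω : Type*} [Ring A] [StarRing A] [HopfAlgebra ℂ A] [StarModule ℂ A]
  [AddCommGroup Γ] [Module ℂ Γ] [Module A Γ] [Module Aᵐᵒᵖ Γ] [SMulCommClass A Aᵐᵒᵖ Γ]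
  [IsScalarTower ℂ A Γ] [IsScalarTower ℂ Aᵐᵒᵖ Γ] [StarAddMonoid Γ] [StarModule ℂ Γ]
  [Ring V] [StarRing V] [Algebra ℂ V] [StarModule ℂ V]
  [Ring B] [StarRing B] [Algebra ℂ B] [StarModule ℂ B]
  [Ring Ω] [Algebra ℂ Ω] [StarAddMonoid Ω] [StarModule ℂ Ω]
  {P : QuantumPrincipalBundle A V B} {C : BicovariantStarCalculus A Γ}
  {𝒢 : ℕ → Submodule ℂ Ω} [GradedAlgebra 𝒢] (D : BundleCalculus P C 𝒢)

/-- The inclusion of `B` in `Ω(P)`. -/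
def incl : B →ₐ[ℂ] Ω :=
  AlgHom.ofLinearMap ((𝒢 0).subtype ∘ₗ D.ofB.toLinearMap) (by simp) (by simp)

theorem incl_mem (b : B) : D.incl b ∈ 𝒢 0 := (D.ofB b).2

theorem d_incl_mem (b : B) : D.d (D.incl b) ∈ 𝒢 1 := D.d_mem 0 _ (D.incl_mem b)

theorem d_incl_mul (b b' : B) :
    D.d (D.incl (b * b')) = D.d (D.incl b) * D.incl b' + D.incl b * D.d (D.incl b') := by
  rw [map_mul, D.d_mul 0 _ (D.incl_mem b)]
  simp

/-- The map `b ⊗ b' ↦ b d(b')`. -/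
def form : B ⊗[ℂ] B →ₗ[ℂ] Ω :=
  LinearMap.mul' ℂ Ω ∘ₗ TensorProduct.map D.incl.toLinearMap (D.d ∘ₗ D.incl.toLinearMap)

@[simp] theorem form_tmul (b b' : B) : D.form (b ⊗ₜ b') = D.incl b * D.d (D.incl b') := rfl

theorem form_mem (t : B ⊗[ℂ] B) : D.form t ∈ 𝒢 1 := by
  induction t with
  | zero => rw [map_zero]; exact zero_mem _
  | add x y hx hy => rw [map_add]; exact add_mem hx hy
  | tmul b b' => simpa using SetLike.mul_mem_graded (D.incl_mem b) (D.d_incl_mem b')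

/-- The sign of the graded involution is (-1)^(0·1) = 1, so the adjoint is d(b'^*) b^*, and the
Leibniz rule moves the coefficient to the left. -/
theorem star_form_tmul (b b' : B) :
    star (D.form (b ⊗ₜ b')) = D.form (1 ⊗ₜ (star b' * star b)) - D.form (star b' ⊗ₜ star b) := by
  have hs : ∀ b, star (D.incl b) = D.incl (star b) := fun b => (D.ofB_star b).symm
  rw [form_tmul, D.star_mul 0 1 _ (D.incl_mem b) _ (D.d_incl_mem b'), ← D.d_star, hs, hs,
    form_tmul, form_tmul, d_incl_mul]
  simp

/-- No sign appears in the graded tensor product because the inner left factor, from A, has degree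
zero. Degrees 0 and 1 of u are the ones that occur in the coaction of b d(b'). -/
theorem of_mul_of (w u : Ω) (a : A) (hu : u ∈ 𝒢 0 ∨ u ∈ 𝒢 1) (v : C.Env) :
    GradedTensorProduct.of ℂ 𝒢 (Envelope.grade C.toFirstOrderCalculus)
        (w ⊗ₜ Envelope.ofA C.toFirstOrderCalculus a) *
      GradedTensorProduct.of ℂ 𝒢 (Envelope.grade C.toFirstOrderCalculus) (u ⊗ₜ v) =
    GradedTensorProduct.of ℂ 𝒢 (Envelope.grade C.toFirstOrderCalculus)
      ((w * u) ⊗ₜ (Envelope.ofA C.toFirstOrderCalculus a * v)) := by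
  let a' : Envelope.grade C.toFirstOrderCalculus 0 := ⟨_, Envelope.ofA_mem _ a⟩
  rcases hu with hu | hu
  · exact GradedTensorProduct.tmul_zero_coe_mul_coe_tmul 𝒢 _ w a' ⟨u, hu⟩ v
  · exact GradedTensorProduct.tmul_zero_coe_mul_coe_tmul 𝒢 _ w a' ⟨u, hu⟩ v

theorem of_mul_of_tensorDifferential (x y : B ⊗[ℂ] A) :
    GradedTensorProduct.of ℂ 𝒢 (Envelope.grade C.toFirstOrderCalculus)
        (TensorProduct.map D.incl.toLinearMap (Envelope.ofA C.toFirstOrderCalculus).toLinearMap x) *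
      GradedTensorProduct.of ℂ 𝒢 (Envelope.grade C.toFirstOrderCalculus)
        (tensorDifferential 𝒢 D.d (Envelope.d C.toFirstOrderCalculus)
          (TensorProduct.map D.incl.toLinearMap
            (Envelope.ofA C.toFirstOrderCalculus).toLinearMap y)) =
    GradedTensorProduct.of ℂ 𝒢 (Envelope.grade C.toFirstOrderCalculus)
      (TensorProduct.map D.form (Envelope.ofA C.toFirstOrderCalculus).toLinearMap
          (diagPair A B x y) +
        TensorProduct.map D.incl.toLinearMap (Envelope.ofΓ C.toFirstOrderCalculus)
          (verPair B C x y)) := by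
  induction x with
  | zero => simp
  | add x x' hx hx' =>
    simp only [map_add, LinearMap.add_apply, add_mul] at hx hx' ⊢
    rw [hx, hx']
    abel
  | tmul b a =>
    induction y with
    | zero => simp
    | add y y' hy hy' =>
      simp only [map_add, mul_add] at hy hy' ⊢
      rw [hy, hy']
      abel
    | tmul c e =>
      have h : gradeSign 𝒢 (D.incl c) = D.incl c := by
        rw [gradeSign_apply 𝒢 (D.incl_mem c), pow_zero, one_smul]
      simp only [tensorDifferential, LinearMap.add_apply, TensorProduct.map_tmul,
        AlgHom.toLinearMap_apply, LinearMap.id_apply, h, Envelope.d_ofA, map_add, mul_add,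
        diagPair_tmul, verPair_tmul, form_tmul]
      rw [of_mul_of _ _ _ (Or.inr (D.d_incl_mem c)), of_mul_of _ _ _ (Or.inl (D.incl_mem c)),
        map_mul, map_mul, Envelope.ofA_mul_ofΓ]

/-- The extended coaction is multiplicative and commutes with d, so b d(b') goes to F(b) times the
total differential of F(b'). Differentiating the first leg gives the diagonal coaction,
differentiating the second gives the vertical part. The projection p₀ kills the second summand, and
the degree-zero part of the first leg kills the first, whence `rightAction_form` and `vert_form`. -/
theorem FhatLin_form (t : B ⊗[ℂ] B) : D.FhatLin (D.form t) =
    TensorProduct.map D.form (Envelope.ofA C.toFirstOrderCalculus).toLinearMap (P.diagCoaction t) +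
      TensorProduct.map D.incl.toLinearMap (Envelope.ofΓ C.toFirstOrderCalculus)
        (P.verForm C t) := by
  induction t with
  | zero => simp
  | add x y hx hy => simp only [map_add, hx, hy]; abel
  | tmul b b' =>
    have h1 : ∀ b, D.Fhat (D.incl b) =
        GradedTensorProduct.of ℂ 𝒢 (Envelope.grade C.toFirstOrderCalculus)
          (TensorProduct.map D.incl.toLinearMap
            (Envelope.ofA C.toFirstOrderCalculus).toLinearMap (P.F b)) := D.Fhat_ofB
    have h2 : D.Fhat (D.d (D.incl b')) =
        GradedTensorProduct.of ℂ 𝒢 (Envelope.grade C.toFirstOrderCalculus)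
          (tensorDifferential 𝒢 D.d (Envelope.d C.toFirstOrderCalculus)
            (TensorProduct.map D.incl.toLinearMap
              (Envelope.ofA C.toFirstOrderCalculus).toLinearMap (P.F b'))) := by
      refine (D.Fhat_d (D.incl b')).trans ?_
      rw [h1]
      rfl
    have h3 : D.Fhat (D.form (b ⊗ₜ b')) = _ :=
      (map_mul D.Fhat _ _).trans ((congrArg₂ (· * ·) (h1 b) h2).trans
        (D.of_mul_of_tensorDifferential (P.F b) (P.F b')))
    exact h3

theorem rightAction_form (t : B ⊗[ℂ] B) :
    D.rightAction (D.form t) = D.form.rTensor A (P.diagCoaction t) := by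
  have h2 : ∀ z : (B ⊗[ℂ] B) ⊗[ℂ] A,
      TensorProduct.map LinearMap.id (Envelope.p₀ C.toFirstOrderCalculus).toLinearMap
        (TensorProduct.map D.form (Envelope.ofA C.toFirstOrderCalculus).toLinearMap z) =
      D.form.rTensor A z := by
    intro z
    induction z with
    | zero => simp
    | add x y hx hy => simp only [map_add, hx, hy]
    | tmul m a => simp [Envelope.p₀]
  have h3 : ∀ z : B ⊗[ℂ] Γ,
      TensorProduct.map LinearMap.id (Envelope.p₀ C.toFirstOrderCalculus).toLinearMap
        (TensorProduct.map D.incl.toLinearMap (Envelope.ofΓ C.toFirstOrderCalculus) z) = 0 := by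
    intro z
    induction z with
    | zero => simp
    | add x y hx hy => simp only [map_add, hx, hy, add_zero]
    | tmul m a => simp [Envelope.p₀]
  rw [rightAction, LinearMap.comp_apply, FhatLin_form, map_add, h2, h3, add_zero]

theorem zeroPart_form (t : B ⊗[ℂ] B) : zeroPart 𝒢 (D.form t) = 0 := by
  refine Subtype.ext ?_
  exact DirectSum.decompose_of_mem_ne 𝒢 (D.form_mem t) one_ne_zero

theorem zeroPart_incl (b : B) : zeroPart 𝒢 (D.incl b) = D.ofB b := by
  refine Subtype.ext ?_
  exact DirectSum.decompose_of_mem_same 𝒢 (D.incl_mem b)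

theorem vert_form (t : B ⊗[ℂ] B) : D.vert (D.form t) =
    TensorProduct.map LinearMap.id (C.invProj ∘ₗ Envelope.ofΓ C.toFirstOrderCalculus)
      (P.verForm C t) := by
  have h2 : ∀ z : (B ⊗[ℂ] B) ⊗[ℂ] A,
      TensorProduct.map (D.ofB.symm.toLinearMap ∘ₗ zeroPart 𝒢) C.invProj
        (TensorProduct.map D.form (Envelope.ofA C.toFirstOrderCalculus).toLinearMap z) = 0 := by
    intro z
    induction z with
    | zero => simp
    | add x y hx hy => simp only [map_add, hx, hy, add_zero]
    | tmul m a => simp [zeroPart_form]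
  have h3 : ∀ z : B ⊗[ℂ] Γ,
      TensorProduct.map (D.ofB.symm.toLinearMap ∘ₗ zeroPart 𝒢) C.invProj
        (TensorProduct.map D.incl.toLinearMap (Envelope.ofΓ C.toFirstOrderCalculus) z) =
      TensorProduct.map LinearMap.id (C.invProj ∘ₗ Envelope.ofΓ C.toFirstOrderCalculus) z := by
    intro z
    induction z with
    | zero => simp
    | add x y hx hy => simp only [map_add, hx, hy]
    | tmul m a => simp [zeroPart_incl]
  rw [vert, LinearMap.comp_apply, FhatLin_form, map_add, h2, h3, zero_add]

/-- The identity of `star_form_tmul` with the A-legs carried along: the involution reverses their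
product, just as it occurs in star y * star x. -/
theorem rTensor_form_star (x y : B ⊗[ℂ] A) :
    star (D.form.rTensor A (diagPair A B x y)) =
      D.form.rTensor A (diagPair A B 1 (star y * star x) - diagPair A B (star y) (star x)) := by
  induction x with
  | zero => simp
  | add x x' hx hx' =>
    simp only [map_add, map_sub, LinearMap.add_apply, star_add, mul_add] at hx hx' ⊢
    rw [hx, hx']
    abel
  | tmul b a =>
    induction y with
    | zero => simp
    | add y y' hy hy' =>
      simp only [map_add, map_sub, LinearMap.add_apply, star_add, add_mul] at hy hy' ⊢
      rw [hy, hy']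
      abel
    | tmul c e =>
      rw [Algebra.TensorProduct.one_def]
      simp only [diagPair_tmul, LinearMap.rTensor_tmul, TensorProduct.star_tmul, star_form_tmul,
        Algebra.TensorProduct.tmul_mul_tmul, map_sub, one_mul, star_mul, TensorProduct.sub_tmul]

/-- The adjoint of a one-form `b d(b')` is again a combination of such forms. -/
theorem exists_star_form (t : B ⊗[ℂ] B) : ∃ t' : B ⊗[ℂ] B, D.form t' = star (D.form t) ∧
    D.form.rTensor A (P.diagCoaction t') = star (D.form.rTensor A (P.diagCoaction t)) ∧
    P.verForm C t' = star (P.verForm C t) := by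
  induction t with
  | zero => exact ⟨0, by simp⟩
  | add x y hx hy =>
    obtain ⟨x', hx1, hx2, hx3⟩ := hx
    obtain ⟨y', hy1, hy2, hy3⟩ := hy
    exact ⟨x' + y', by simp only [map_add, star_add, hx1, hy1],
      by simp only [map_add, star_add, hx2, hy2], by simp only [map_add, star_add, hx3, hy3]⟩
  | tmul b b' =>
    -- The witness is read off from `star_form_tmul`; the other two identities hold because F is a
    -- unital `*`-homomorphism.
    refine ⟨1 ⊗ₜ (star b' * star b) - star b' ⊗ₜ star b, ?_, ?_, ?_⟩
    · rw [star_form_tmul, map_sub]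
    · rw [diagCoaction_tmul, rTensor_form_star, map_sub, diagCoaction_tmul, diagCoaction_tmul,
        map_one, map_mul, map_star, map_star]
    · rw [verForm_tmul, star_verPair, map_sub, verForm_tmul, verForm_tmul,
        map_one, map_mul, map_star, map_star]

/-! ### Hermitian averaging and the existence theorem -/

variable [IsCompactMatrixQuantumGroup A]

/-- The hermitian part `ϑ ↦ ½ (ω(ϑ) + ω(ϑ^*)^*)`. -/
def hermitianPart (ω : C.inv →ₗ[ℂ] Ω) : C.inv →ₗ[ℂ] Ω where
  toFun ϑ := (2⁻¹ : ℂ) • (ω ϑ + star (ω (star ϑ)))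
  map_add' x y := by simp only [star_add, map_add, ← smul_add]; congr 1; abel
  map_smul' c x := by simp [smul_comm c]

theorem hermitianPart_apply (ω : C.inv →ₗ[ℂ] Ω) (ϑ : C.inv) :
    hermitianPart ω ϑ = (2⁻¹ : ℂ) • (ω ϑ + star (ω (star ϑ))) := rfl

theorem rTensor_hermitianPart (ω : C.inv →ₗ[ℂ] Ω) (z : C.inv ⊗[ℂ] A) :
    (hermitianPart ω).rTensor A z = (2⁻¹ : ℂ) • (ω.rTensor A z + star (ω.rTensor A (star z))) := by
  induction z with
  | zero => simp
  | add x y hx hy => simp only [map_add, star_add, hx, hy, ← smul_add]; congr 1; abel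
  | tmul m a =>
    simp [hermitianPart_apply, TensorProduct.smul_tmul', TensorProduct.add_tmul]

theorem map_add_half_smul {M N : Type*} [AddCommGroup M] [Module ℂ M] [AddCommGroup N]
    [Module ℂ N] (f : M →ₗ[ℂ] N) (x y : M) :
    f ((2⁻¹ : ℂ) • (x + y)) = (2⁻¹ : ℂ) • (f x + f y) := by
  rw [map_smul, map_add]

theorem exists_isConnection : ∃ ω : C.inv →ₗ[ℂ] Ω, D.IsConnection ω := by
  obtain ⟨s, hs1, hs2⟩ := P.exists_equivariant_section C
  -- `J` is an arbitrary choice function, not known to be antilinear. Only its images under the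
  -- three maps are used; linearity of ω comes from `hermitianPart`.
  choose J hJ1 hJ2 hJ3 using D.exists_star_form
  have hω : ∀ ϑ : C.inv, hermitianPart (D.form ∘ₗ s) ϑ =
      (2⁻¹ : ℂ) • (D.form (s ϑ) + D.form (J (s (star ϑ)))) := fun ϑ => by
    rw [hJ1]; rfl
  refine ⟨hermitianPart (D.form ∘ₗ s), ⟨fun ϑ => ?_, fun ϑ => ?_, fun ϑ => ?_, fun ϑ => ?_⟩⟩
  · rw [hω]
    exact Submodule.smul_mem _ _ (add_mem (D.form_mem _) (D.form_mem _))
  · have h := rTensor_hermitianPart (A := A) (D.form ∘ₗ s) (C.adjointCoaction ϑ)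
    refine Eq.trans ?_ h.symm
    rw [hω, map_add_half_smul, rightAction_form, rightAction_form, hJ2, hs2, hs2,
      C.adjointCoaction_star, LinearMap.rTensor_comp]
    rfl
  · rw [hermitianPart_apply, hermitianPart_apply, star_star, star_smul, star_add, star_star,
      add_comm]
    simp
  -- Both summands of the average have vertical part 1 ⊗ ϑ, the second because the involution is
  -- applied twice; the factor ½ then restores 1 ⊗ ϑ, which π_inv fixes.
  · have h : star (oneTensor B C (star ϑ)) = oneTensor B C ϑ := by
      simp [BicovariantStarCalculus.coe_star_inv]
    rw [hω, map_add_half_smul, vert_form, vert_form, hJ3, hs1, hs1, h, ← two_smul ℂ, smul_smul,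
      inv_mul_cancel₀ two_ne_zero, one_smul, oneTensor_apply, TensorProduct.map_tmul,
      LinearMap.comp_apply, C.invProj_ofΓ ϑ.2, LinearMap.id_apply]

end BundleCalculus

end QuantumBundle

end

theorem mainTheorem1 {A Γ V B Ω : Type*}
    [Ring A] [StarRing A] [HopfAlgebra ℂ A] [StarModule ℂ A]
    [QuantumBundle.IsCompactMatrixQuantumGroup A]
    [AddCommGroup Γ] [Module ℂ Γ] [Module A Γ] [Module Aᵐᵒᵖ Γ] [SMulCommClass A Aᵐᵒᵖ Γ]
    [IsScalarTower ℂ A Γ] [IsScalarTower ℂ Aᵐᵒᵖ Γ] [StarAddMonoid Γ] [StarModule ℂ Γ]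
    [Ring V] [StarRing V] [Algebra ℂ V] [StarModule ℂ V]
    [Ring B] [StarRing B] [Algebra ℂ B] [StarModule ℂ B]
    [Ring Ω] [Algebra ℂ Ω] [StarAddMonoid Ω] [StarModule ℂ Ω]
    (P : QuantumBundle.QuantumPrincipalBundle A V B)
    (C : QuantumBundle.BicovariantStarCalculus A Γ)
    (𝒢 : ℕ → Submodule ℂ Ω) [GradedAlgebra 𝒢]
    (D : QuantumBundle.BundleCalculus P C 𝒢) :
    ∃ ω : C.inv →ₗ[ℂ] Ω, D.IsConnection ω :=
  D.exists_isConnection
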